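/- **Setting.** Identify $\mathbb R^4=\mathbb H$, $\mathbb R^3=\operatorname{Im}\mathbb H$, $S^2=\{n\in\operatorname{Im}\mathbb H: n^2=-1\}$; for a 1-form $\omega$ on a Riemann surface put $*\omega(X)=\omega(JX)$. Complex numbers act on $\mathbb H$ and $\mathbb H^2$ by right multiplication, and $I$ is right multiplication by $i$; for an endomorphism valued 1-form $B$ put $B^{(1,0)}=\frac12(B-I{*B})$, $B^{(0,1)}=\frac12(B+I{*B})$. Let $M$ be a connected Riemann surface with universal cover $\pi:\tilde M\to M$, and let $f:M\to\mathbb R^3$ be a CMC surface, normalised to mean curvature $1$: a smooth immersion with Gauss map $N:M\to S^2$, $*df=N\,df=-df\,N$ and $-df=\frac12(dN-N{*dN})$. Data on $M$ are lifted to $\tilde M$. *CMC associated family.* For $\lambda\in\mathbb C\setminus\{0\}$ let $d^N_\lambda=d+(\lambda-1)A_N^{(1,0)}+(\lambda^{-1}-1)A_N^{(0,1)}$ with $A_N=\frac14({*dN}+N\,dN)$, on the trivial $\mathbb H$-bundle. Let $s\in\mathbb R$, $\mu=e^{is}$, and let $\alpha:\tilde M\to\mathbb H$ be a non-trivial $d^N_\mu$-parallel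 section. Let $\alpha(t)$, for $t$ near $s$, be any extension of $\alpha=\alpha(s)$ by $d^N_{e^{it}}$-parallel sections that is smooth in $t$ and in the point of $\tilde M$, and put $$f^\alpha=A^N_{\alpha,s}(f)=-2\,\alpha^{-1}\,\tfrac{d}{dt}\alpha(t)\big|_{t=s}:\tilde M\to\mathbb H,\qquad N^\alpha=\alpha^{-1}N\alpha .$$ *Constrained Willmore associated family.* Put $\psi=\binom{f^\alpha}{1}$, $L^\alpha=\psi\mathbb H\subset\tilde M\times\mathbb H^2$. A conformal Gauss map of $f^\alpha$ is a smooth $S^\alpha:\tilde M\to\operatorname{End}_{\mathbb H}(\mathbb H^2)$ with $(S^\alpha)^2=-1$, $S^\alpha L^\alpha=L^\alpha$, $S^\alpha\psi=-\psi N^\alpha$, $(dS^\alpha)L^\alpha\subset L^\alpha$, and Hopf field $A=\frac14(S^\alpha dS^\alpha+{*dS^\alpha})$ with values in $L^\alpha$. With $g=f^\alpha+N^\alpha$, $F=\begin{pmatrix}1&f^\alpha\\0&1\end{pmatrix}$, $\eta=-\frac14F\begin{pmatrix}0&0\\dg&0\end{pmatrix}F^{-1}$ and $\hat A=A+\eta$,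 let $$d^{S^\alpha}_\lambda=d+(\lambda-1)\hat A^{(1,0)}+(\lambda^{-1}-1)\hat A^{(0,1)}$$ on the trivial $\mathbb H^2$-bundle over $\tilde M$. For $\lambda\in S^1$ and $\Phi:\tilde M\to GL(2,\mathbb H)$ with $d^{S^\alpha}_\lambda$-parallel columns, $A^{S^\alpha}_{\Phi,\lambda}(f^\alpha)$ is the map $\tilde M\to\mathbb{HP}^1$ given by the line bundle $\Phi^{-1}L^\alpha$. Möbius transformations are the maps of $\mathbb{HP}^1$ induced by $GL(2,\mathbb H)$. **Theorem.** 1. For some $c\in\mathbb R$, $f^\alpha-c$ is a CMC surface in $\mathbb R^3$ with Gauss map $N^\alpha$ and mean curvature $1$; and $f^\alpha$ has a conformal Gauss map. 2. Let $S^\alpha$ be a conformal Gauss map of $f^\alpha$. For all $\lambda\in S^1\setminus\{1\}$ close enough to $1$ there is a map $\Phi:\tilde M\to GL(2,\mathbb H)$ with $d^{S^\alpha}_\lambda$-parallel columns. For every choice of such maps $\Phi_\lambda$, for $\lambda\in S^1\setminus\{1\}$ near $1$, we have, up to Möbius transformation, $$\lim_{\lambda\to1}A^{S^\alpha}_{\Phi_\lambda,\lambda}(f^\alpha)=f^\alpha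 ,$$ that is: there are $m_\lambda\in GL(2,\mathbb H)$, depending only on $\lambda$ and not on the point of $\tilde M$, and maps $f_\lambda:\tilde M\to\mathbb H$ such that, for all $\lambda\ne1$ near $1$ in $S^1$, $m_\lambda\Phi_\lambda(p)^{-1}L^\alpha_p=\binom{f_\lambda(p)}{1}\mathbb H$ for all $p\in\tilde M$, and $f_\lambda\to f^\alpha$ locally uniformly on $\tilde M$ as $\lambda\to1$. -/

import Mathlib

open Filter Topology
open scoped Manifold ContDiff Quaternion

namespace CMCFamily

noncomputable section

/-- The quaternions `ℍ` model `ℝ⁴`, the imaginary quaternions `Im ℍ` model `ℝ³`.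
Quaternionic `2 × 2` matrices. They act from the left on columns in `ℍ²`, hence are exactly the
endomorphisms of the right quaternionic vector space `ℍ²`. -/
abbrev QMat : Type := Matrix (Fin 2) (Fin 2) ℍ[ℝ]

/-- `GL(2, ℍ)`, the group inducing the orientation preserving Möbius transformations of `ℍP¹`. -/
abbrev QGL : Type := QMatˣ

/-! ### Calculus on a Riemann surface

A Riemann surface is a manifold modelled on `ℂ` with holomorphic coordinate changes. Its real
tangent space at `p` is identified with `ℂ` by the preferred chart at `p`, and the complex structure
`J` of the tangent space is then multiplication by `i`. -/

section Calculus

variable {X : Type*} [TopologicalSpace X] [ChartedSpace ℂ X]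

/-- Smoothness of a quaternion valued map on the underlying real surface. -/
def Smooth (h : X → ℍ[ℝ]) : Prop := ContMDiff 𝓘(ℝ, ℂ) 𝓘(ℝ, ℍ[ℝ]) ∞ h

/-- The real differential `dh` of a quaternion valued map. -/
def qdiff (h : X → ℍ[ℝ]) (p : X) (v : ℂ) : ℍ[ℝ] := mfderiv 𝓘(ℝ, ℂ) 𝓘(ℝ, ℍ[ℝ]) h p v

/-- The differential of a column valued map. -/
def diffVec (φ : X → Fin 2 → ℍ[ℝ]) (p : X) (v : ℂ) : Fin 2 → ℍ[ℝ] :=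
  fun i => qdiff (fun q => φ q i) p v

/-- The differential of a matrix valued map. -/
def diffMat (S : X → QMat) (p : X) (v : ℂ) : QMat :=
  Matrix.of fun i j => qdiff (fun q => S q i j) p v

/-- `(*θ)(v) = θ(J v)`. -/
def hodge {V : Type*} (θ : X → ℂ → V) (p : X) (v : ℂ) : V := θ p (Complex.I * v)

end Calculus

/-- The value of `(lam - 1) B^{(1,0)} φ + (lam⁻¹ - 1) B^{(0,1)} φ`, where `x = B φ`, `y = (*B) φ`,
`B^{(1,0)} = (B - I *B) / 2`, `B^{(0,1)} = (B + I *B) / 2`, and where `I` and complex scalars act by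
right multiplication. -/
def spectralPart (lam : ℂ) (x y : ℍ[ℝ]) : ℍ[ℝ] :=
  ((1 / 2 : ℝ) • (x - y * (Complex.I : ℍ[ℝ]))) * ((lam - 1 : ℂ) : ℍ[ℝ]) +
    ((1 / 2 : ℝ) • (x + y * (Complex.I : ℍ[ℝ]))) * ((lam⁻¹ - 1 : ℂ) : ℍ[ℝ])

/-! ### Conformal immersions and CMC surfaces -/

section Surfaces

variable {X : Type*} [TopologicalSpace X] [ChartedSpace ℂ X]

/-- `f` is a conformal immersion into `ℝ⁴ = ℍ` with left normal `N` and right normal `R`: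
`*df = N df = -df R` with `N, R : X → S² = {n ∈ Im ℍ | n² = -1}`. -/
structure IsConformalImmersion (f N R : X → ℍ[ℝ]) : Prop where
  smooth : Smooth f
  smooth_left : Smooth N
  smooth_right : Smooth R
  immersion : ∀ p, Function.Injective (qdiff f p)
  left_mem : ∀ p, (N p).re = 0 ∧ N p * N p = -1
  right_mem : ∀ p, (R p).re = 0 ∧ R p * R p = -1
  star_left : ∀ p v, hodge (qdiff f) p v = N p * qdiff f p v
  star_right : ∀ p v, hodge (qdiff f) p v = -(qdiff f p v * R p)

/-- The conformal immersion `f` into `ℝ³ = Im ℍ` with Gauss map `N` has mean curvature `H`: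
`-H df = (dN)'`, where `(dN)' = (dN - N *dN) / 2`. -/
def HasMeanCurvature (f N : X → ℍ[ℝ]) (H : X → ℝ) : Prop :=
  ∀ p v, -(H p • qdiff f p v) = (1 / 2 : ℝ) • (qdiff N p v - N p * hodge (qdiff N) p v)

/-- `f : X → ℝ³ = Im ℍ` is a conformal immersion with Gauss map `N` and constant mean curvature
`H = 1`. -/
structure IsCMC (f N : X → ℍ[ℝ]) : Prop where
  conformal : IsConformalImmersion f N N
  imaginary : ∀ p, (f p).re = 0
  mean_curvature : HasMeanCurvature f N fun _ => 1

/-! ### The family `d^N_lam` and the CMC associated family -/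

/-- `A = (*dN + N dN) / 4`. -/
def gaussHopf (N : X → ℍ[ℝ]) (p : X) (v : ℂ) : ℍ[ℝ] :=
  (1 / 4 : ℝ) • (hodge (qdiff N) p v + N p * qdiff N p v)

/-- `d^N_lam α = dα + (lam - 1) A^{(1,0)} α + (lam⁻¹ - 1) A^{(0,1)} α`. -/
def connN (N : X → ℍ[ℝ]) (lam : ℂ) (α : X → ℍ[ℝ]) (p : X) (v : ℂ) : ℍ[ℝ] :=
  qdiff α p v + spectralPart lam (gaussHopf N p v * α p) (hodge (gaussHopf N) p v * α p)

/-- `α` is a `d^N_lam`-parallel section of the trivial `ℍ`-bundle. -/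
def IsParallelN (N : X → ℍ[ℝ]) (lam : ℂ) (α : X → ℍ[ℝ]) : Prop :=
  Smooth α ∧ ∀ p v, connN N lam α p v = 0

/-- `αt t`, for `t` near `s`, is a `d^N_lam`-parallel extension of `α = αt s`, where
`lam = exp (i t)`, which is smooth in `t` and in the point of the surface. -/
def IsParallelExtension (N : X → ℍ[ℝ]) (s : ℝ) (α : X → ℍ[ℝ]) (αt : ℝ → X → ℍ[ℝ]) : Prop :=
  αt s = α ∧ ∃ ε > 0,
    ContMDiffOn (𝓘(ℝ, ℝ).prod 𝓘(ℝ, ℂ)) 𝓘(ℝ, ℍ[ℝ]) ∞ (fun q : ℝ × X => αt q.1 q.2)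
      (Set.Ioo (s - ε) (s + ε) ×ˢ Set.univ) ∧
    ∀ t ∈ Set.Ioo (s - ε) (s + ε), IsParallelN N (Complex.exp (t * Complex.I)) (αt t)

/-- `fα` is a surface `A^N_{α,s}(f)` of the CMC associated family, given by the Sym-Bobenko formula
`fα = -2 α⁻¹ (d/dt α)|_{t=s}`. -/
def IsAssociatedCMC (N : X → ℍ[ℝ]) (s : ℝ) (α fα : X → ℍ[ℝ]) : Prop :=
  ∃ αt : ℝ → X → ℍ[ℝ], IsParallelExtension N s α αt ∧
    ∀ p, fα p = -2 * (α p)⁻¹ * deriv (fun t => αt t p) s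

/-- `N^α = α⁻¹ N α`. -/
def gaugedNormal (N α : X → ℍ[ℝ]) (p : X) : ℍ[ℝ] := (α p)⁻¹ * N p * α p

/-! ### The conformal Gauss map and the constrained Willmore associated family -/

/-- `ψ = (x, 1)`, spanning the point of `ℍP¹` with affine coordinate `x`. -/
def psi (x : ℍ[ℝ]) : Fin 2 → ℍ[ℝ] := ![x, 1]

/-- The quaternionic line `w ℍ ⊆ ℍ²`. -/
def quatLine (w : Fin 2 → ℍ[ℝ]) : Set (Fin 2 → ℍ[ℝ]) := {u | ∃ q : ℍ[ℝ], u = fun i => w i * q}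

/-- The line bundle `L = ψ ℍ` of `f`. -/
def lineBundle (f : X → ℍ[ℝ]) (p : X) : Set (Fin 2 → ℍ[ℝ]) := quatLine (psi (f p))

/-- The Hopf field `A = (S dS + *dS) / 4` of a complex structure `S` on `ℍ²`. -/
def hopfField (S : X → QMat) (p : X) (v : ℂ) : QMat :=
  (1 / 4 : ℝ) • (S p * diffMat S p v + hodge (diffMat S) p v)

/-- `S` is the conformal Gauss map of the conformal immersion `f` with left normal `N`:
`S² = -1`, `S L = L` with `S|_L = J` (where `J ψ = -ψ N`), `dS L ⊆ L`, and the Hopf field of `S`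
takes values in `L`. -/
structure IsConformalGaussMap (f N : X → ℍ[ℝ]) (S : X → QMat) : Prop where
  smooth : ∀ i j, Smooth fun p => S p i j
  sq : ∀ p, S p * S p = -1
  map_line : ∀ p, (fun w => (S p).mulVec w) '' lineBundle f p = lineBundle f p
  eq_J : ∀ p, (S p).mulVec (psi (f p)) = fun i => -(psi (f p) i * N p)
  diff_line : ∀ p v, ∀ w ∈ lineBundle f p, (diffMat S p v).mulVec w ∈ lineBundle f p
  hopf_line : ∀ p v w, (hopfField S p v).mulVec w ∈ lineBundle f p

/-- The Lagrange multiplier `η = -1/4 F (0 0; dg 0) F⁻¹` of a CMC surface `f` with Gauss map `N`,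
where `F = (1 f; 0 1)` and `g = f + N` is the parallel CMC surface. -/
def cwEta (f N : X → ℍ[ℝ]) (p : X) (v : ℂ) : QMat :=
  (-(1 / 4) : ℝ) • (!![1, f p; 0, 1] * !![0, 0; qdiff (fun q => f q + N q) p v, 0] *
    !![1, -f p; 0, 1])

/-- `Â = A + η`. -/
def hatA (f N : X → ℍ[ℝ]) (S : X → QMat) (p : X) (v : ℂ) : QMat :=
  hopfField S p v + cwEta f N p v

/-- `d^S_lam φ = dφ + (lam - 1) Â^{(1,0)} φ + (lam⁻¹ - 1) Â^{(0,1)} φ`. -/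
def connS (f N : X → ℍ[ℝ]) (S : X → QMat) (lam : ℂ) (φ : X → Fin 2 → ℍ[ℝ]) (p : X) (v : ℂ) :
    Fin 2 → ℍ[ℝ] :=
  diffVec φ p v + fun i => spectralPart lam ((hatA f N S p v).mulVec (φ p) i)
    ((hodge (hatA f N S) p v).mulVec (φ p) i)

/-- `φ` is a `d^S_lam`-parallel section of the trivial `ℍ²`-bundle. -/
def IsParallelS (f N : X → ℍ[ℝ]) (S : X → QMat) (lam : ℂ) (φ : X → Fin 2 → ℍ[ℝ]) : Prop :=
  (∀ i, Smooth fun p => φ p i) ∧ ∀ p v, connS f N S lam φ p v = 0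

/-- `Φ = (φ₁, φ₂)` is an invertible endomorphism of the trivial `ℍ²`-bundle both of whose columns
are `d^S_lam`-parallel. -/
def IsParallelFrame (f N : X → ℍ[ℝ]) (S : X → QMat) (lam : ℂ) (Φ : X → QGL) : Prop :=
  ∀ j, IsParallelS f N S lam fun p i => (Φ p : QMat) i j

/-- The image of a subset of `ℍ²`, in particular of a point of `ℍP¹`, under a Möbius
transformation. -/
def moebius (m : QGL) (ℓ : Set (Fin 2 → ℍ[ℝ])) : Set (Fin 2 → ℍ[ℝ]) :=
  (fun w => (m : QMat).mulVec w) '' ℓ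

/-- The line bundle `L^Φ = Φ⁻¹ L` of the surface `A^S_{Φ,lam}(f)` in the constrained Willmore
associated family, for a `d^S_lam`-parallel `Φ`. -/
def cwAssociated (f : X → ℍ[ℝ]) (Φ : X → QGL) (p : X) : Set (Fin 2 → ℍ[ℝ]) :=
  moebius (Φ p)⁻¹ (lineBundle f p)

end Surfaces

end

end CMCFamily

open CMCFamily

namespace CMCFamily

/-! ### Calculus of quaternion valued maps on a Riemann surface -/

section RealStructure

/-! Everything is explicit in terms of the Sym-Bobenko family. Mean curvature 1 turns the Hopf form
of N into -*df/2, so for lam = exp(it) the d^N_lam-parallel equation reads dα = θ_t α with θ_t =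
((cos t - 1) *df - sin t df)/2. Its coefficient is imaginary, so non-trivial solutions have constant
length and vanish nowhere. Differentiating in t gives df^α = α⁻¹(cos s df + sin s *df)α
(`qdiff_symBobenko`): up to conjugation by α the tangent plane is rotated, and f^α is CMC after a
real translation (`gaugedNormal_isCMC`).

The conformal Gauss map of such a surface exists and is unique (`isConformalGaussMap_gaussS`,
`IsConformalGaussMap.eq_gaussS`). For it, Â has a vanishing first column, and the d^S_lam-parallel
equation decouples into an equation of the above form for the parallel surface g = f + N and a
quadrature (`connS_gaussS`). The gauge 1 - tan(t/2) N carries solutions β for f to solutions for g,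
and the quadrature is solved by 2β/sin t. This gives a frame for which Φ⁻¹L is the surface -2β/sin t
(`frame_of_parallel`); all other frames differ from it by a constant matrix (`frame_const`), that
is, by a Möbius transformation.

For f^α one may take β = α⁻¹α(s+t). After a translation by 2/sin t the surface is -(2/sin t)(β - 1),
a difference quotient that tends to -2α⁻¹α'(s) = f^α. -/

theorem two_le_infty : (2 : ℕ∞ω) ≤ ∞ := by
  have : (2 : ℕ∞ω) = ((2 : ℕ∞) : ℕ∞ω) := rfl
  rw [this]
  exact WithTop.coe_le_coe.2 le_top

variable {X : Type*} [TopologicalSpace X] [ChartedSpace ℂ X]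

theorem isManifold_real [IsManifold 𝓘(ℂ, ℂ) ω X] : IsManifold 𝓘(ℝ, ℂ) ω X := by
  apply isManifold_of_contDiffOn
  intro e e' he he'
  have h := HasGroupoid.compatible (G := contDiffGroupoid ω 𝓘(ℂ, ℂ)) he he'
  rw [contDiffGroupoid, mem_groupoid_of_pregroupoid] at h
  have h2 := h.1
  simp only [contDiffPregroupoid] at h2
  exact ContDiffOn.restrict_scalars ℝ h2

variable {h k : X → ℍ[ℝ]} {p : X}

theorem Smooth.mdifferentiableAt (hh : Smooth h) (p : X) :
    MDifferentiableAt 𝓘(ℝ, ℂ) 𝓘(ℝ, ℍ[ℝ]) h p :=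
  (ContMDiff.contMDiffAt hh).mdifferentiableAt (by simp)

theorem Smooth.continuous (hh : Smooth h) : Continuous h := ContMDiff.continuous hh

theorem smooth_const (c : ℍ[ℝ]) : Smooth fun _ : X => c := contMDiff_const

theorem Smooth.add (hh : Smooth h) (hk : Smooth k) : Smooth fun q => h q + k q :=
  (contDiff_fst.add contDiff_snd : ContDiff ℝ ∞ fun z : ℍ[ℝ] × ℍ[ℝ] => z.1 + z.2).comp_contMDiff
    (hh.prodMk_space hk)

theorem Smooth.mul (hh : Smooth h) (hk : Smooth k) : Smooth fun q => h q * k q :=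
  (contDiff_fst.mul contDiff_snd : ContDiff ℝ ∞ fun z : ℍ[ℝ] × ℍ[ℝ] => z.1 * z.2).comp_contMDiff
    (hh.prodMk_space hk)

theorem Smooth.neg (hh : Smooth h) : Smooth fun q => -h q :=
  (contDiff_neg : ContDiff ℝ ∞ fun z : ℍ[ℝ] => -z).comp_contMDiff hh

theorem Smooth.sub (hh : Smooth h) (hk : Smooth k) : Smooth fun q => h q - k q := by
  simpa only [sub_eq_add_neg] using hh.add hk.neg

theorem Smooth.smul (a : ℝ) (hh : Smooth h) : Smooth fun q => a • h q :=
  (contDiff_id.const_smul a : ContDiff ℝ ∞ fun z : ℍ[ℝ] => a • z).comp_contMDiff hh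

theorem Smooth.inv (hh : Smooth h) (h0 : ∀ q, h q ≠ 0) : Smooth fun q => (h q)⁻¹ := by
  intro q
  have h1 : ContDiffAt ℝ ∞ (fun z : ℍ[ℝ] => z⁻¹) (h q) := by
    have := contDiffAt_ringInverse ℝ (n := ∞) (Units.mk0 (h q) (h0 q))
    rwa [Ring.inverse_eq_inv'] at this
  exact h1.comp_contMDiffAt (hh q)

theorem hasMFDerivAt_qdiff (hh : Smooth h) (p : X) :
    HasMFDerivAt 𝓘(ℝ, ℂ) 𝓘(ℝ, ℍ[ℝ]) h p (mfderiv 𝓘(ℝ, ℂ) 𝓘(ℝ, ℍ[ℝ]) h p) :=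
  (hh.mdifferentiableAt p).hasMFDerivAt

theorem qdiff_const (c : ℍ[ℝ]) (p : X) (v : ℂ) : qdiff (fun _ : X => c) p v = 0 := by
  unfold qdiff
  rw [mfderiv_const]; rfl

theorem qdiff_add (hh : Smooth h) (hk : Smooth k) (p : X) (v : ℂ) :
    qdiff (fun q => h q + k q) p v = qdiff h p v + qdiff k p v := by
  have := ((hasMFDerivAt_qdiff hh p).add (hasMFDerivAt_qdiff hk p)).mfderiv
  exact DFunLike.congr_fun this v

theorem qdiff_neg (h : X → ℍ[ℝ]) (p : X) (v : ℂ) :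
    qdiff (fun q => -h q) p v = -qdiff h p v := by
  have := mfderiv_neg (I := 𝓘(ℝ, ℂ)) (f := h) (x := p)
  exact DFunLike.congr_fun this v

theorem qdiff_sub (hh : Smooth h) (hk : Smooth k) (p : X) (v : ℂ) :
    qdiff (fun q => h q - k q) p v = qdiff h p v - qdiff k p v := by
  have := ((hasMFDerivAt_qdiff hh p).sub (hasMFDerivAt_qdiff hk p)).mfderiv
  exact DFunLike.congr_fun this v

theorem qdiff_smul (a : ℝ) (hh : Smooth h) (p : X) (v : ℂ) :
    qdiff (fun q => a • h q) p v = a • qdiff h p v := by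
  have := ((hasMFDerivAt_qdiff hh p).const_smul a).mfderiv
  exact DFunLike.congr_fun this v

theorem qdiff_mul (hh : Smooth h) (hk : Smooth k) (p : X) (v : ℂ) :
    qdiff (fun q => h q * k q) p v = h p * qdiff k p v + qdiff h p v * k p := by
  have := ((hasMFDerivAt_qdiff hh p).mul' (hasMFDerivAt_qdiff hk p)).mfderiv
  exact DFunLike.congr_fun this v

theorem qdiff_inv (hh : Smooth h) (h0 : ∀ q, h q ≠ 0) (p : X) (v : ℂ) :
    qdiff (fun q => (h q)⁻¹) p v = -((h p)⁻¹ * qdiff h p v * (h p)⁻¹) := by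
  have h1 := qdiff_mul hh (hh.inv h0) p v
  simp only [mul_inv_cancel₀ (h0 _), qdiff_const] at h1
  have h2 : (h p)⁻¹ * (h p * qdiff (fun q => (h q)⁻¹) p v) = qdiff (fun q => (h q)⁻¹) p v := by
    rw [← mul_assoc, inv_mul_cancel₀ (h0 p), one_mul]
  rw [← h2, eq_neg_of_add_eq_zero_left h1.symm]
  noncomm_ring

theorem qdiff_neg_right (h : X → ℍ[ℝ]) (p : X) (v : ℂ) : qdiff h p (-v) = -qdiff h p v :=
  map_neg (mfderiv 𝓘(ℝ, ℂ) 𝓘(ℝ, ℍ[ℝ]) h p) v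

theorem qdiff_I_I (h : X → ℍ[ℝ]) (p : X) (v : ℂ) :
    qdiff h p (Complex.I * (Complex.I * v)) = -qdiff h p v := by
  rw [← mul_assoc, Complex.I_mul_I, neg_one_mul, qdiff_neg_right]

/-- The differential is the derivative in the preferred chart. -/
theorem qdiff_eq_fderiv (hh : Smooth h) (p : X) (v : ℂ) :
    qdiff h p v = fderiv ℝ (h ∘ (chartAt ℂ p).symm) (chartAt ℂ p p) v := by
  have h1 := (hh.mdifferentiableAt p).mfderiv
  have h2 : fderivWithin ℝ (writtenInExtChartAt 𝓘(ℝ, ℂ) 𝓘(ℝ, ℍ[ℝ]) p h) (Set.range 𝓘(ℝ, ℂ))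
      (extChartAt 𝓘(ℝ, ℂ) p p) = fderiv ℝ (h ∘ (chartAt ℂ p).symm) (chartAt ℂ p p) := by
    rw [modelWithCornersSelf_coe, Set.range_id, fderivWithin_univ]
    rfl
  exact (DFunLike.congr_fun h1 v).trans (DFunLike.congr_fun h2 v)

theorem Smooth.contDiffOn_chart [IsManifold 𝓘(ℂ, ℂ) ω X] (hh : Smooth h) (p : X) :
    ContDiffOn ℝ ∞ (h ∘ (chartAt ℂ p).symm) (chartAt ℂ p).target := by
  have : IsManifold 𝓘(ℝ, ℂ) ω X := isManifold_real
  have h1 := (hh.contMDiffOn (s := Set.univ)).comp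
    (contMDiffOn_chart_symm (I := 𝓘(ℝ, ℂ)) (n := ∞) (x := p)) (fun _ _ => trivial)
  exact h1.contDiffOn

/-- A map with vanishing differential on a connected surface is constant. -/
theorem Smooth.eq_of_qdiff_eq_zero [IsManifold 𝓘(ℂ, ℂ) ω X] [PreconnectedSpace X]
    (hh : Smooth h) (h0 : ∀ p v, qdiff h p v = 0) (p q : X) : h p = h q := by
  have : IsManifold 𝓘(ℝ, ℂ) ω X := isManifold_real
  refine IsLocallyConstant.apply_eq_of_isPreconnected
    ((IsLocallyConstant.iff_eventually_eq h).2 fun x => ?_) isPreconnected_univ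
    (Set.mem_univ p) (Set.mem_univ q)
  have hmem : chartAt ℂ x x ∈ (chartAt ℂ x).target := mem_chart_target ℂ x
  obtain ⟨r, hr, hball⟩ := Metric.isOpen_iff.1 (chartAt ℂ x).open_target _ hmem
  have hconst : ∀ z ∈ Metric.ball (chartAt ℂ x x) r,
      (h ∘ (chartAt ℂ x).symm) z = (h ∘ (chartAt ℂ x).symm) (chartAt ℂ x x) := by
    intro z hz
    refine Metric.isOpen_ball.is_const_of_fderiv_eq_zero (𝕜 := ℝ)
      (convex_ball _ _).isPreconnected
      (((hh.contDiffOn_chart x).mono hball).differentiableOn (by simp)) ?_ hz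
      (Metric.mem_ball_self hr)
    intro w hw
    -- `qdiff` at a nearby point uses the preferred chart of that point, not the fixed chart at `x`;
    -- the chain rule absorbs the change of chart.
    have h1 : MDifferentiableAt 𝓘(ℝ, ℂ) 𝓘(ℝ, ℂ) (chartAt ℂ x).symm w :=
      ((contMDiffOn_chart_symm (I := 𝓘(ℝ, ℂ)) (n := ∞) (x := x)).contMDiffAt
        ((chartAt ℂ x).open_target.mem_nhds (hball hw))).mdifferentiableAt (by simp)
    have h2 := mfderiv_comp w (hh.mdifferentiableAt _) h1
    rw [mfderiv_eq_fderiv] at h2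
    rw [h2]
    ext1 v
    exact h0 _ _
  have hev : ∀ᶠ y in 𝓝 x, chartAt ℂ x y ∈ Metric.ball (chartAt ℂ x x) r :=
    ((chartAt ℂ x).continuousAt (mem_chart_source ℂ x)).preimage_mem_nhds
      (Metric.ball_mem_nhds _ hr)
  filter_upwards [hev, (chartAt ℂ x).open_source.mem_nhds (mem_chart_source ℂ x)] with y hy hys
  have := hconst _ hy
  simpa [(chartAt ℂ x).left_inv hys] using this

end RealStructure

/-! ### Pullback under holomorphic local diffeomorphisms -/

section Pullback

variable {X Y : Type*} [TopologicalSpace X] [ChartedSpace ℂ X] [TopologicalSpace Y]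
  [ChartedSpace ℂ Y]

/-- A holomorphic local diffeomorphism is smooth and its real differential is multiplication by a
non-vanishing complex function. -/
theorem qdiff_comp_localDiffeomorph [IsManifold 𝓘(ℂ, ℂ) ω X] [IsManifold 𝓘(ℂ, ℂ) ω Y]
    {π : X → Y} (hπ : IsLocalDiffeomorph 𝓘(ℂ, ℂ) 𝓘(ℂ, ℂ) ω π) :
    (∀ h : Y → ℍ[ℝ], Smooth h → Smooth (h ∘ π)) ∧
      ∃ c : X → ℂ, (∀ p, c p ≠ 0) ∧ ∀ h : Y → ℍ[ℝ], Smooth h → ∀ p v,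
        qdiff (h ∘ π) p v = qdiff h (π p) (c p * v) := by
  have : IsManifold 𝓘(ℝ, ℂ) ω X := isManifold_real
  have : IsManifold 𝓘(ℝ, ℂ) ω Y := isManifold_real
  have hC : ContMDiff 𝓘(ℂ, ℂ) 𝓘(ℂ, ℂ) ω π := hπ.contMDiff
  have hR : ContMDiff 𝓘(ℝ, ℂ) 𝓘(ℝ, ℂ) ∞ π := by
    rw [contMDiff_iff] at hC ⊢
    exact ⟨hC.1, fun x y => ((hC.2 x y).restrict_scalars ℝ).of_le le_top⟩
  refine ⟨fun h hh => ContMDiff.comp hh hR, ?_⟩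
  have hder : ∀ p : X, ∃ c : ℂ, c ≠ 0 ∧
      HasMFDerivAt 𝓘(ℝ, ℂ) 𝓘(ℝ, ℂ) π p ((c • (1 : ℂ →L[ℝ] ℂ) : ℂ →L[ℝ] ℂ)) := by
    intro p
    have h1 : HasMFDerivAt 𝓘(ℂ, ℂ) 𝓘(ℂ, ℂ) π p (mfderiv 𝓘(ℂ, ℂ) 𝓘(ℂ, ℂ) π p) :=
      ((hC p).mdifferentiableAt (by simp)).hasMFDerivAt
    set D : ℂ →L[ℂ] ℂ := mfderiv 𝓘(ℂ, ℂ) 𝓘(ℂ, ℂ) π p with hD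
    have hinj : Function.Injective D :=
      ((hπ p).mfderivToContinuousLinearEquiv (by simp)).injective
    -- A ℂ-linear map of ℂ is multiplication by its value at 1, which is non-zero by injectivity.
    refine ⟨D 1, fun h0 => one_ne_zero (hinj (h0.trans (map_zero D).symm)), h1.1, ?_⟩
    have h2 : HasFDerivWithinAt (writtenInExtChartAt 𝓘(ℂ, ℂ) 𝓘(ℂ, ℂ) p π) D
      (Set.range 𝓘(ℂ, ℂ)) (extChartAt 𝓘(ℂ, ℂ) p p) := h1.2
    have h3 := h2.restrictScalars ℝ
    have h4 : D.restrictScalars ℝ = D 1 • (1 : ℂ →L[ℝ] ℂ) := by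
      ext1 v
      have : D v = v • D 1 := by rw [← map_smul, smul_eq_mul, mul_one]
      exact this.trans (mul_comm _ _)
    rw [h4] at h3
    exact h3
  choose c hc hcd using hder
  refine ⟨c, hc, fun h hh p v => ?_⟩
  have := ((hasMFDerivAt_qdiff hh (π p)).comp p (hcd p)).mfderiv
  exact DFunLike.congr_fun this v

end Pullback

/-! ### Smooth one-parameter families of maps -/

section Parameter

variable {X : Type*} [TopologicalSpace X] [ChartedSpace ℂ X] [IsManifold 𝓘(ℂ, ℂ) ω X]
  {s ε : ℝ} {αt : ℝ → X → ℍ[ℝ]}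

theorem contDiffOn_family (hε : ContMDiffOn (𝓘(ℝ, ℝ).prod 𝓘(ℝ, ℂ)) 𝓘(ℝ, ℍ[ℝ]) ∞
      (fun q : ℝ × X => αt q.1 q.2) (Set.Ioo (s - ε) (s + ε) ×ˢ Set.univ)) (p : X) :
    ContDiffOn ℝ ∞ (fun z : ℝ × ℂ => αt z.1 ((chartAt ℂ p).symm z.2))
      (Set.Ioo (s - ε) (s + ε) ×ˢ (chartAt ℂ p).target) := by
  have : IsManifold 𝓘(ℝ, ℂ) ω X := isManifold_real
  have h1 : ContMDiffOn (𝓘(ℝ, ℝ).prod 𝓘(ℝ, ℂ)) (𝓘(ℝ, ℝ).prod 𝓘(ℝ, ℂ)) ∞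
      (Prod.map id (chartAt ℂ p).symm : ℝ × ℂ → ℝ × X)
      (Set.Ioo (s - ε) (s + ε) ×ˢ (chartAt ℂ p).target) :=
    contMDiffOn_id.prodMap (contMDiffOn_chart_symm (I := 𝓘(ℝ, ℂ)) (n := ∞) (x := p))
  have h2 := hε.comp h1 (fun z hz => ⟨hz.1, trivial⟩)
  rw [← modelWithCornersSelf_prod, chartedSpaceSelf_prod] at h2
  exact h2.contDiffOn

/-- The parameter derivative at `t = s` of a smooth family of maps is smooth, its differential is
the parameter derivative of the differentials, and it is the limit, locally uniformly, of the
difference quotients. -/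
theorem family_deriv (hε0 : 0 < ε)
    (hε : ContMDiffOn (𝓘(ℝ, ℝ).prod 𝓘(ℝ, ℂ)) 𝓘(ℝ, ℍ[ℝ]) ∞
      (fun q : ℝ × X => αt q.1 q.2) (Set.Ioo (s - ε) (s + ε) ×ˢ Set.univ))
    (hsm : ∀ t ∈ Set.Ioo (s - ε) (s + ε), Smooth (αt t)) :
    Smooth (fun p => deriv (fun t => αt t p) s) ∧
    (∀ p, HasDerivAt (fun t => αt t p) (deriv (fun t => αt t p) s) s) ∧
    (∀ p v, HasDerivAt (fun t => qdiff (αt t) p v)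
      (qdiff (fun p => deriv (fun t => αt t p) s) p v) s) ∧
    ∀ x, Tendsto (fun z : ℝ × X => z.1⁻¹ • (αt (s + z.1) z.2 - αt s z.2)) (𝓝[≠] 0 ×ˢ 𝓝 x)
      (𝓝 (deriv (fun t => αt t x) s)) := by
  have : IsManifold 𝓘(ℝ, ℂ) ω X := isManifold_real
  have hs : s ∈ Set.Ioo (s - ε) (s + ε) := ⟨by linarith, by linarith⟩
  have hsn : Set.Ioo (s - ε) (s + ε) ∈ 𝓝 s := Ioo_mem_nhds hs.1 hs.2
  have hG : ∀ p : X, ∀ w ∈ (chartAt ℂ p).target, ContDiffAt ℝ ∞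
      (fun z : ℝ × ℂ => αt z.1 ((chartAt ℂ p).symm z.2)) (s, w) := fun p w hw =>
    (contDiffOn_family hε p).contDiffAt
      (prod_mem_nhds hsn ((chartAt ℂ p).open_target.mem_nhds hw))
  have hpart : ∀ p : X, ∀ w ∈ (chartAt ℂ p).target,
      HasDerivAt (fun t => αt t ((chartAt ℂ p).symm w))
        (fderiv ℝ (fun z : ℝ × ℂ => αt z.1 ((chartAt ℂ p).symm z.2)) (s, w) (1, 0)) s := by
    intro p w hw
    have h1 := ((hG p w hw).differentiableAt (by simp)).hasFDerivAt
    have h2 : HasDerivAt (fun t : ℝ => (t, w)) ((1 : ℝ), (0 : ℂ)) s :=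
      (hasDerivAt_id s).prodMk (hasDerivAt_const s w)
    exact h1.comp_hasDerivAt s h2
  have hchart : ∀ p : X, ∀ y ∈ (chartAt ℂ p).source, deriv (fun t => αt t y) s =
      fderiv ℝ (fun z : ℝ × ℂ => αt z.1 ((chartAt ℂ p).symm z.2)) (s, chartAt ℂ p y) (1, 0) := by
    intro p y hy
    have := hpart p _ ((chartAt ℂ p).map_source hy)
    rw [(chartAt ℂ p).left_inv hy] at this
    exact this.deriv
  have hfd : ∀ p : X, ∀ w ∈ (chartAt ℂ p).target, ContDiffAt ℝ ∞
      (fun z => fderiv ℝ (fun z : ℝ × ℂ => αt z.1 ((chartAt ℂ p).symm z.2)) z) (s, w) :=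
    fun p w hw => (hG p w hw).fderiv_right (by simp)
  have hsmooth : Smooth (fun p => deriv (fun t => αt t p) s) := by
    intro p
    have h1 : ContDiffAt ℝ ∞ (fun w => fderiv ℝ
        (fun z : ℝ × ℂ => αt z.1 ((chartAt ℂ p).symm z.2)) (s, w) (1, 0)) (chartAt ℂ p p) := by
      have h2 : ContDiffAt ℝ ∞ (fun w : ℂ => (s, w)) (chartAt ℂ p p) :=
        contDiffAt_const.prodMk contDiffAt_id
      exact ((hfd p _ (mem_chart_target ℂ p)).comp _ h2).clm_apply contDiffAt_const
    have h3 : ContMDiffAt 𝓘(ℝ, ℂ) 𝓘(ℝ, ℂ) ∞ (chartAt ℂ p) p :=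
      (contMDiffOn_chart (I := 𝓘(ℝ, ℂ)) (n := ∞) (x := p)).contMDiffAt
        ((chartAt ℂ p).open_source.mem_nhds (mem_chart_source ℂ p))
    refine (h1.comp_contMDiffAt h3).congr_of_eventuallyEq ?_
    filter_upwards [(chartAt ℂ p).open_source.mem_nhds (mem_chart_source ℂ p)] with y hy
    exact hchart p y hy
  refine ⟨hsmooth, ?_, ?_, ?_⟩
  · intro p
    have := hpart p _ (mem_chart_target ℂ p)
    rw [(chartAt ℂ p).left_inv (mem_chart_source ℂ p)] at this
    exact this.differentiableAt.hasDerivAt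
  · intro p v
    set G := fun z : ℝ × ℂ => αt z.1 ((chartAt ℂ p).symm z.2) with hGdef
    set w := chartAt ℂ p p with hw
    have hwt : w ∈ (chartAt ℂ p).target := mem_chart_target ℂ p
    have hD2 : ∀ u, HasFDerivAt (fun z => fderiv ℝ G z u)
        ((fderiv ℝ (fderiv ℝ G) (s, w)).flip u) (s, w) := fun u => by
      simpa using (((hfd p w hwt).differentiableAt (by simp)).hasFDerivAt).clm_apply
        (hasFDerivAt_const u (s, w))
    -- Symmetry of the second derivative exchanges the parameter derivative with the differential
    -- along the surface.
    have hsym : IsSymmSndFDerivAt ℝ G (s, w) :=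
      (hG p w hwt).isSymmSndFDerivAt (by simpa using two_le_infty)
    have hleft : HasDerivAt (fun t : ℝ => fderiv ℝ G (t, w) (0, v))
        (fderiv ℝ (fderiv ℝ G) (s, w) (1, 0) (0, v)) s := by
      have h2 : HasDerivAt (fun t : ℝ => (t, w)) ((1 : ℝ), (0 : ℂ)) s :=
        (hasDerivAt_id s).prodMk (hasDerivAt_const s w)
      exact (hD2 (0, v)).comp_hasDerivAt s h2
    have hright : qdiff (fun p => deriv (fun t => αt t p) s) p v =
        fderiv ℝ (fderiv ℝ G) (s, w) (0, v) (1, 0) := by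
      rw [qdiff_eq_fderiv hsmooth]
      have h2 : HasFDerivAt (fun u : ℂ => (s, u)) (ContinuousLinearMap.inr ℝ ℝ ℂ) w :=
        (hasFDerivAt_const s w).prodMk (hasFDerivAt_id w)
      have h4 := (hD2 (1, 0)).comp w h2
      have h5 : ((fun p => deriv (fun t => αt t p) s) ∘ (chartAt ℂ p).symm) =ᶠ[𝓝 w]
          fun u => fderiv ℝ G (s, u) (1, 0) := by
        filter_upwards [(chartAt ℂ p).open_target.mem_nhds hwt] with u hu
        exact (hpart p u hu).deriv
      rw [h5.fderiv_eq]
      have h6 := h4.fderiv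
      simp only [Function.comp_def] at h6
      rw [h6]
      simp
    rw [hright, hsym.eq]
    refine hleft.congr_of_eventuallyEq ?_
    filter_upwards [hsn] with t ht
    rw [qdiff_eq_fderiv (hsm t ht)]
    have h1 : DifferentiableAt ℝ G (t, w) :=
      ((contDiffOn_family hε p).contDiffAt
        (prod_mem_nhds (Ioo_mem_nhds ht.1 ht.2)
          ((chartAt ℂ p).open_target.mem_nhds hwt))).differentiableAt (by simp)
    have h2 : HasFDerivAt (fun u : ℂ => (t, u)) (ContinuousLinearMap.inr ℝ ℝ ℂ) w :=
      (hasFDerivAt_const t w).prodMk (hasFDerivAt_id w)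
    have h3 := (h1.hasFDerivAt.comp w h2).fderiv
    have h4 : αt t ∘ (chartAt ℂ p).symm = G ∘ fun u : ℂ => (t, u) := rfl
    rw [h4, h3]
    simp
  · intro x
    set G := fun z : ℝ × ℂ => αt z.1 ((chartAt ℂ x).symm z.2) with hGdef
    set w := chartAt ℂ x x with hw
    have hwt : w ∈ (chartAt ℂ x).target := mem_chart_target ℂ x
    -- Strict differentiability lets the base point move: the remainder estimate holds jointly as t
    -- → 0 and the point tends to `x`, hence locally uniformly.
    have hstr : HasStrictFDerivAt G (fderiv ℝ G (s, w)) (s, w) :=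
      (hG x w hwt).hasStrictFDerivAt (by simp)
    rw [hchart x x (mem_chart_source ℂ x)]
    have hφ : Tendsto (fun z : ℝ × X => (((s + z.1, chartAt ℂ x z.2) : ℝ × ℂ),
        ((s, chartAt ℂ x z.2) : ℝ × ℂ))) (𝓝[≠] 0 ×ˢ 𝓝 x) (𝓝 ((s, w), (s, w))) := by
      have h1 : Tendsto (fun z : ℝ × X => s + z.1) (𝓝[≠] 0 ×ˢ 𝓝 x) (𝓝 s) := by
        have : Tendsto (fun t : ℝ => s + t) (𝓝[≠] 0) (𝓝 s) := by
          have h := (continuous_const_add s).tendsto 0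
          exact (show Tendsto (fun t : ℝ => s + t) (𝓝 0) (𝓝 s) by simpa only [id_eq, add_zero] using h).mono_left nhdsWithin_le_nhds
        exact this.comp tendsto_fst
      have h2 : Tendsto (fun z : ℝ × X => chartAt ℂ x z.2) (𝓝[≠] 0 ×ˢ 𝓝 x) (𝓝 w) :=
        ((chartAt ℂ x).continuousAt (mem_chart_source ℂ x)).tendsto.comp tendsto_snd
      exact (h1.prodMk_nhds h2).prodMk_nhds (tendsto_const_nhds.prodMk_nhds h2)
    have hlo := (hasStrictFDerivAt_iff_isLittleO.1 hstr).comp_tendsto hφ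
    have hlo2 : (fun z : ℝ × X => αt (s + z.1) z.2 - αt s z.2 - z.1 • fderiv ℝ G (s, w) (1, 0))
        =o[𝓝[≠] 0 ×ˢ 𝓝 x] fun z : ℝ × X => z.1 := by
      refine (hlo.congr' ?_ ?_).trans_isBigO (g := fun z : ℝ × X => (z.1, (0 : ℂ))) ?_
      · have : ∀ᶠ z : ℝ × X in 𝓝[≠] 0 ×ˢ 𝓝 x, z.2 ∈ (chartAt ℂ x).source :=
          tendsto_snd.eventually ((chartAt ℂ x).open_source.mem_nhds (mem_chart_source ℂ x))
        filter_upwards [this] with z hz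
        have h1 : ((s + z.1, chartAt ℂ x z.2) : ℝ × ℂ) - (s, chartAt ℂ x z.2)
            = z.1 • ((1 : ℝ), (0 : ℂ)) := by ext <;> simp
        simp only [Function.comp_apply, h1, map_smul, hGdef, (chartAt ℂ x).left_inv hz]
      · exact Filter.Eventually.of_forall fun z => by
          show ((s + z.1, chartAt ℂ x z.2) : ℝ × ℂ) - (s, chartAt ℂ x z.2) = (z.1, (0 : ℂ))
          ext <;> simp
      · exact Asymptotics.isBigO_of_le _ fun z => by simp [Prod.norm_def]
    have hne : ∀ᶠ z : ℝ × X in 𝓝[≠] 0 ×ˢ 𝓝 x, z.1 ≠ 0 :=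
      tendsto_fst.eventually eventually_mem_nhdsWithin
    have h0 := (hlo2.tendsto_inv_smul_nhds_zero).add_const (fderiv ℝ G (s, w) (1, 0))
    rw [zero_add] at h0
    refine h0.congr' ?_
    filter_upwards [hne] with z hz
    rw [smul_sub, smul_smul, inv_mul_cancel₀ hz, one_smul, sub_add_cancel]

end Parameter

/-! ### Quaternionic algebra -/

/-- On the unit circle the inverse of lam is its conjugate, so the terms with a single right factor
i cancel and a real combination of B and *B remains. This removes the complex structure I from all
later computations. -/
theorem spectralPart_of_norm_eq_one {lam : ℂ} (h : ‖lam‖ = 1) (x y : ℍ[ℝ]) :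
    spectralPart lam x y = (lam.re - 1) • x + lam.im • y := by
  have hinv : lam⁻¹ = (starRingEnd ℂ) lam := by
    rw [Complex.inv_def, Complex.normSq_eq_norm_sq, h]; simp
  have h1 : ((lam - 1 : ℂ) : ℍ[ℝ]) = (lam.re - 1) • (1 : ℍ[ℝ]) + lam.im • (Complex.I : ℍ[ℝ]) := by
    ext <;> simp
  have h2 : ((lam⁻¹ - 1 : ℂ) : ℍ[ℝ]) =
      (lam.re - 1) • (1 : ℍ[ℝ]) - lam.im • (Complex.I : ℍ[ℝ]) := by
    rw [hinv]; ext <;> simp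
  have h3 : (Complex.I : ℍ[ℝ]) * (Complex.I : ℍ[ℝ]) = -1 := by
    ext <;> simp
  rw [spectralPart, h1, h2]
  simp only [mul_add, mul_sub, add_mul, sub_mul, smul_add, smul_sub, smul_mul_assoc,
    mul_smul_comm, mul_assoc, h3, mul_one, mul_neg, smul_neg]
  module

/-- The imaginary components of q² are 2 Re(q) times those of q. If Re(q) were non-zero, q would be
real with negative square. -/
theorem re_eq_zero_of_mul_self {q : ℍ[ℝ]} (h : q * q = -1) : q.re = 0 := by
  have h0 := congrArg QuaternionAlgebra.re h
  have h1 := congrArg QuaternionAlgebra.imI h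
  have h2 := congrArg QuaternionAlgebra.imJ h
  have h3 := congrArg QuaternionAlgebra.imK h
  simp only [Quaternion.re_mul, Quaternion.imI_mul, Quaternion.imJ_mul, Quaternion.imK_mul,
    Quaternion.re_neg, Quaternion.imI_neg, Quaternion.imJ_neg, Quaternion.imK_neg,
    Quaternion.re_one, Quaternion.imI_one, Quaternion.imJ_one, Quaternion.imK_one] at h0 h1 h2 h3
  by_contra hne
  have e1 : q.imI = 0 := by
    have : q.re * q.imI = 0 := by linarith
    exact (mul_eq_zero.1 this).resolve_left hne
  have e2 : q.imJ = 0 := by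
    have : q.re * q.imJ = 0 := by linarith
    exact (mul_eq_zero.1 this).resolve_left hne
  have e3 : q.imK = 0 := by
    have : q.re * q.imK = 0 := by linarith
    exact (mul_eq_zero.1 this).resolve_left hne
  rw [e1, e2, e3] at h0
  nlinarith [mul_self_nonneg q.re]

theorem conj_mul_conj {γ α : ℍ[ℝ]} (h : α * γ = 1) (a b : ℍ[ℝ]) :
    (γ * a * α) * (γ * b * α) = γ * (a * b) * α := by
  have : (γ * a * α) * (γ * b * α) = γ * a * (α * γ) * (b * α) := by noncomm_ring
  rw [this, h]; noncomm_ring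

theorem star_eq_neg_of_re_eq_zero {q : ℍ[ℝ]} (h : q.re = 0) : star q = -q :=
  Quaternion.star_eq_neg.2 h

instance : StarModule ℝ ℍ[ℝ] := ⟨fun r q => by ext <;> simp⟩

/-! ### Conjugation of quaternion valued maps -/

section Star

variable {X : Type*} [TopologicalSpace X] [ChartedSpace ℂ X] {h : X → ℍ[ℝ]}

theorem smooth_star (hh : Smooth h) : Smooth fun q => star (h q) :=
  ((starL' ℝ : ℍ[ℝ] ≃L[ℝ] ℍ[ℝ]).contDiff : ContDiff ℝ ∞ _).comp_contMDiff hh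

theorem qdiff_star (hh : Smooth h) (p : X) (v : ℂ) :
    qdiff (fun q => star (h q)) p v = star (qdiff h p v) := by
  have h1 := ((starL' ℝ : ℍ[ℝ] ≃L[ℝ] ℍ[ℝ]).hasFDerivAt (x := h p)).hasMFDerivAt
  exact DFunLike.congr_fun (h1.comp p (hasMFDerivAt_qdiff hh p)).mfderiv v

end Star

section CMC

variable {X : Type*} [TopologicalSpace X] [ChartedSpace ℂ X] {f N : X → ℍ[ℝ]}

/-! ### Consequences of the CMC equations -/

theorem IsConformalImmersion.normal_anticomm (hc : IsConformalImmersion f N N) (p : X) (v : ℂ) :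
    qdiff f p v * N p = -(N p * qdiff f p v) := by
  rw [← hc.star_left p v, hc.star_right p v, neg_neg]

theorem IsConformalImmersion.normal_mul_normal (hc : IsConformalImmersion f N N) (p : X)
    (w : ℍ[ℝ]) : N p * (N p * w) = -w := by
  rw [← mul_assoc, (hc.left_mem p).2, neg_one_mul]

theorem IsConformalImmersion.star (hc : IsConformalImmersion f N N) (p : X) (v : ℂ) :
    qdiff f p (Complex.I * v) = N p * qdiff f p v := hc.star_left p v

theorem HasMeanCurvature.qdiff_normal (hH : HasMeanCurvature f N fun _ => 1) (p : X) (v : ℂ) :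
    qdiff N p v = N p * qdiff N p (Complex.I * v) - (2 : ℝ) • qdiff f p v := by
  have h := hH p v
  simp only [hodge, one_smul] at h
  have h2 : qdiff f p v = -((1 / 2 : ℝ) • (qdiff N p v - N p * qdiff N p (Complex.I * v))) := by
    rw [← h, neg_neg]
  rw [h2]
  module

/-- Mean curvature 1, evaluated on Jv, gives *dN + N dN = -2 *df. The connection form thus involves
only df and *df. -/
theorem gaussHopf_eq (hH : HasMeanCurvature f N fun _ => 1) (p : X) (v : ℂ) :
    gaussHopf N p v = -((1 / 2 : ℝ) • qdiff f p (Complex.I * v)) := by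
  have h := hH.qdiff_normal p (Complex.I * v)
  rw [qdiff_I_I, mul_neg] at h
  rw [gaussHopf, hodge, h]
  module

theorem hodge_gaussHopf_eq (hH : HasMeanCurvature f N fun _ => 1) (p : X) (v : ℂ) :
    hodge (gaussHopf N) p v = (1 / 2 : ℝ) • qdiff f p v := by
  rw [hodge, gaussHopf_eq hH, qdiff_I_I, smul_neg, neg_neg]

/-- Parallel sections of `d^N_lam`, `lam = exp (i t)`, in terms of the surface. -/
theorem IsParallelN.qdiff_eq (hH : HasMeanCurvature f N fun _ => 1) {t : ℝ} {α : X → ℍ[ℝ]}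
    (hα : IsParallelN N (Complex.exp (t * Complex.I)) α) (p : X) (v : ℂ) :
    qdiff α p v = ((1 / 2 : ℝ) • ((Real.cos t - 1) • qdiff f p (Complex.I * v)
      - Real.sin t • qdiff f p v)) * α p := by
  have h := hα.2 p v
  rw [connN, spectralPart_of_norm_eq_one (Complex.norm_exp_ofReal_mul_I t), gaussHopf_eq hH,
    hodge_gaussHopf_eq hH, Complex.exp_ofReal_mul_I_re, Complex.exp_ofReal_mul_I_im] at h
  rw [eq_neg_of_add_eq_zero_left h]
  simp only [smul_mul_assoc, neg_mul, sub_mul]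
  module

theorem IsCMC.star_qdiff (hf : IsCMC f N) (p : X) (v : ℂ) :
    star (qdiff f p v) = -qdiff f p v := by
  rw [← qdiff_star hf.conformal.smooth, ← qdiff_neg]
  congr 1
  funext q
  exact star_eq_neg_of_re_eq_zero (hf.imaginary q)

/-- Parallel sections have constant length, hence vanish nowhere unless they are trivial. -/
theorem IsParallelN.ne_zero [IsManifold 𝓘(ℂ, ℂ) ω X] [PreconnectedSpace X] (hf : IsCMC f N)
    {t : ℝ} {α : X → ℍ[ℝ]} (hα : IsParallelN N (Complex.exp (t * Complex.I)) α) {p : X}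
    (hp : α p ≠ 0) (q : X) : α q ≠ 0 := by
  -- The coefficient θ of the parallel equation takes imaginary values because f does, so the
  -- differential of `star α * α` is `star α * (star θ + θ) * α = 0`.
  have hconst := Smooth.eq_of_qdiff_eq_zero ((smooth_star hα.1).mul hα.1) (fun p v => by
    rw [qdiff_mul (smooth_star hα.1) hα.1, qdiff_star hα.1, hα.qdiff_eq hf.mean_curvature]
    simp only [star_mul, star_smul, star_sub, star_trivial, hf.star_qdiff]
    simp only [mul_assoc, smul_mul_assoc, mul_smul_comm, sub_mul, mul_sub, neg_mul, mul_neg]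
    module) p q
  intro hq
  rw [hq, mul_zero] at hconst
  rcases mul_eq_zero.1 hconst with h | h
  · exact hp (star_eq_zero.1 h)
  · exact hp h

/-- The lift of a CMC surface under a holomorphic local diffeomorphism. -/
theorem IsCMC.comp_localDiffeomorph {Y : Type*} [TopologicalSpace Y] [ChartedSpace ℂ Y]
    [IsManifold 𝓘(ℂ, ℂ) ω X] [IsManifold 𝓘(ℂ, ℂ) ω Y] (hf : IsCMC f N) {π : Y → X}
    (hπ : IsLocalDiffeomorph 𝓘(ℂ, ℂ) 𝓘(ℂ, ℂ) ω π) : IsCMC (f ∘ π) (N ∘ π) := by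
  obtain ⟨hsm, c, hc0, hc⟩ := qdiff_comp_localDiffeomorph hπ
  have hcf := hc f hf.conformal.smooth
  have hcN := hc N hf.conformal.smooth_left
  have hcomm : ∀ p v, c p * (Complex.I * v) = Complex.I * (c p * v) := fun p v => by ring
  refine ⟨⟨hsm f hf.conformal.smooth, hsm N hf.conformal.smooth_left,
    hsm N hf.conformal.smooth_left, ?_, fun p => hf.conformal.left_mem _,
    fun p => hf.conformal.left_mem _, ?_, ?_⟩, fun p => hf.imaginary _, ?_⟩
  · intro p v w hvw
    rw [hcf, hcf] at hvw
    exact mul_left_cancel₀ (hc0 p) (hf.conformal.immersion _ hvw)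
  · intro p v
    rw [hodge, hcf, hcf, hcomm]
    exact hf.conformal.star_left _ _
  · intro p v
    rw [hodge, hcf, hcf, hcomm]
    exact hf.conformal.star_right _ _
  · intro p v
    rw [hodge, hcf, hcN, hcN, hcomm]
    exact hf.mean_curvature _ _

/-! ### The CMC associated family -/

/-- The Sym-Bobenko formula: the differential of a surface in the associated family. -/
theorem qdiff_symBobenko [IsManifold 𝓘(ℂ, ℂ) ω X] (hH : HasMeanCurvature f N fun _ => 1)
    {s ε : ℝ} {αt : ℝ → X → ℍ[ℝ]} (hε0 : 0 < ε)
    (hε : ContMDiffOn (𝓘(ℝ, ℝ).prod 𝓘(ℝ, ℂ)) 𝓘(ℝ, ℍ[ℝ]) ∞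
      (fun q : ℝ × X => αt q.1 q.2) (Set.Ioo (s - ε) (s + ε) ×ˢ Set.univ))
    (hpar : ∀ t ∈ Set.Ioo (s - ε) (s + ε), IsParallelN N (Complex.exp (t * Complex.I)) (αt t))
    (hne : ∀ p, αt s p ≠ 0) {fα : X → ℍ[ℝ]}
    (hfα : ∀ p, fα p = -2 * (αt s p)⁻¹ * deriv (fun t => αt t p) s) :
    Smooth fα ∧ ∀ p v, qdiff fα p v = (αt s p)⁻¹ *
      (Real.cos s • qdiff f p v + Real.sin s • qdiff f p (Complex.I * v)) * αt s p := by
  obtain ⟨hsm, hder, hqder, -⟩ := family_deriv hε0 hε (fun t ht => (hpar t ht).1)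
  have hs : s ∈ Set.Ioo (s - ε) (s + ε) := ⟨by linarith, by linarith⟩
  have hαs := (hpar s hs).1
  have hfα' : fα = fun p => (-2 : ℝ) • ((αt s p)⁻¹ * deriv (fun t => αt t p) s) := by
    funext p
    rw [hfα p, mul_assoc, ← Quaternion.coe_mul_eq_smul]
    congr 1
    push_cast
    rfl
  have hprod := (hαs.inv hne).mul hsm
  refine ⟨hfα' ▸ hprod.smul (-2), fun p v => ?_⟩
  rw [hfα', qdiff_smul _ hprod, qdiff_mul (hαs.inv hne) hsm, qdiff_inv hαs hne,
    (hpar s hs).qdiff_eq hH]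
  -- The t-derivative of dα_t = θ_t α_t is dα' = θ'α + θα'. In d(α⁻¹α') the θ terms cancel, leaving
  -- α⁻¹θ'α; the factor -2 then gives the stated form.
  have hθ : HasDerivAt (fun t => (1 / 2 : ℝ) • ((Real.cos t - 1) • qdiff f p (Complex.I * v)
      - Real.sin t • qdiff f p v)) ((1 / 2 : ℝ) • ((-Real.sin s) • qdiff f p (Complex.I * v)
      - Real.cos s • qdiff f p v)) s :=
    ((((Real.hasDerivAt_cos s).sub_const 1).smul_const _).sub
      ((Real.hasDerivAt_sin s).smul_const _)).const_smul (1 / 2 : ℝ)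
  have h1 := (hθ.mul (hder p)).congr_of_eventuallyEq (f₁ := fun t => qdiff (αt t) p v) (by
    filter_upwards [Ioo_mem_nhds hs.1 hs.2] with t ht
    exact (hpar t ht).qdiff_eq hH p v)
  rw [(hqder p v).unique h1]
  have h2 : ∀ w, αt s p * ((αt s p)⁻¹ * w) = w := fun w => by
    rw [← mul_assoc, mul_inv_cancel₀ (hne p), one_mul]
  simp only [mul_add, add_mul, mul_sub, sub_mul, smul_mul_assoc, mul_smul_comm, mul_assoc, neg_mul, h2]
  module

/-- Differential of the gauged Gauss map. -/
theorem qdiff_gaugedNormal (hN : Smooth N) {α θ : X → ℍ[ℝ]} {v : ℂ} {p : X} (hα : Smooth α)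
    (hne : ∀ p, α p ≠ 0) (hθ : qdiff α p v = θ p * α p) :
    qdiff (gaugedNormal N α) p v =
      (α p)⁻¹ * (qdiff N p v + N p * θ p - θ p * N p) * α p := by
  have h1 : gaugedNormal N α = fun p => (α p)⁻¹ * N p * α p := rfl
  have h2 : ∀ w, α p * ((α p)⁻¹ * w) = w := fun w => by
    rw [← mul_assoc, mul_inv_cancel₀ (hne p), one_mul]
  rw [h1, qdiff_mul ((hα.inv hne).mul hN) hα, qdiff_mul (hα.inv hne) hN, qdiff_inv hα hne, hθ]
  simp only [mul_add, add_mul, mul_sub, sub_mul, mul_assoc, h2, neg_mul]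
  abel

/-- Conjugation by α respects products, so the conformality relations for df and N pass to f^α and
N^α. The differential of f^α is imaginary, so its real part is a constant, read off at `p₀`. -/
theorem gaugedNormal_isCMC [IsManifold 𝓘(ℂ, ℂ) ω X] [PreconnectedSpace X] (hf : IsCMC f N)
    {s : ℝ} {α fα : X → ℍ[ℝ]} (hα : IsParallelN N (Complex.exp (s * Complex.I)) α)
    (hne : ∀ p, α p ≠ 0) (hsm : Smooth fα)
    (hd : ∀ p v, qdiff fα p v = (α p)⁻¹ *
      (Real.cos s • qdiff f p v + Real.sin s • qdiff f p (Complex.I * v)) * α p) (p₀ : X) :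
    IsCMC (fun p => fα p - (((fα p₀).re : ℝ) : ℍ[ℝ])) (gaugedNormal N α) := by
  have hc := hf.conformal
  have hdc : ∀ p v, qdiff (fun p => fα p - (((fα p₀).re : ℝ) : ℍ[ℝ])) p v = qdiff fα p v :=
    fun p v => by rw [qdiff_sub hsm (smooth_const _), qdiff_const, sub_zero]
  have hsmN : Smooth (gaugedNormal N α) := ((hα.1.inv hne).mul hc.smooth_left).mul hα.1
  have hinv : ∀ p, α p * (α p)⁻¹ = 1 := fun p => mul_inv_cancel₀ (hne p)
  have hsq : ∀ p, gaugedNormal N α p * gaugedNormal N α p = -1 := fun p => by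
    rw [gaugedNormal, conj_mul_conj (hinv p), (hc.left_mem p).2, mul_neg, mul_one, neg_mul,
      inv_mul_cancel₀ (hne p)]
  have hmem : ∀ p, (gaugedNormal N α p).re = 0 ∧ gaugedNormal N α p * gaugedNormal N α p = -1 :=
    fun p => ⟨re_eq_zero_of_mul_self (hsq p), hsq p⟩
  have hcs : Real.cos s ^ 2 + Real.sin s ^ 2 = 1 := Real.cos_sq_add_sin_sq s
  have hleft : ∀ p v, qdiff fα p (Complex.I * v) = gaugedNormal N α p * qdiff fα p v := by
    intro p v
    rw [hd, hd, gaugedNormal, conj_mul_conj (hinv p), qdiff_I_I, hc.star]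
    simp only [mul_add, mul_smul_comm, hc.normal_mul_normal]
  have hright : ∀ p v, qdiff fα p (Complex.I * v) = -(qdiff fα p v * gaugedNormal N α p) := by
    intro p v
    have h1 : (Real.cos s • qdiff f p v + Real.sin s • (N p * qdiff f p v)) * N p =
        -(Real.cos s • (N p * qdiff f p v) + Real.sin s • -qdiff f p v) := by
      simp only [add_mul, smul_mul_assoc, mul_assoc, hc.normal_anticomm, hc.normal_mul_normal,
        mul_neg]
      module
    rw [hd, hd, gaugedNormal, conj_mul_conj (hinv p), qdiff_I_I, hc.star, h1, mul_neg, neg_mul,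
      neg_neg]
  refine ⟨⟨hsm.sub (smooth_const _), hsmN, hsmN, ?_, hmem, hmem, ?_, ?_⟩, ?_, ?_⟩
  · intro p v w hvw
    rw [hdc, hdc] at hvw
    apply hc.immersion p
    -- Undoes the conjugation and rotates back by the angle -s, so that df^α determines df and
    -- injectivity is inherited.
    have key : ∀ u, qdiff f p u =
        α p * (Real.cos s • qdiff fα p u - Real.sin s • qdiff fα p (Complex.I * u)) * (α p)⁻¹ := by
      intro u
      have h2 : ∀ w, α p * ((α p)⁻¹ * w) = w := fun w => by rw [← mul_assoc, hinv, one_mul]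
      rw [hd, hd, qdiff_I_I]
      simp only [mul_add, mul_sub, add_mul, sub_mul, mul_smul_comm, smul_mul_assoc, mul_assoc, h2,
        hinv, mul_one, mul_neg, neg_mul]
      conv_lhs => rw [← one_smul ℝ (qdiff f p u), ← hcs]
      module
    rw [key v, key w, hleft, hleft, hvw]
  · intro p v
    rw [hodge, hdc, hdc, hleft]
  · intro p v
    rw [hodge, hdc, hdc, hright]
  · intro p
    have hconst := Smooth.eq_of_qdiff_eq_zero (hsm.add (smooth_star hsm)) (fun q v => ?_) p p₀
    · have h := congrArg QuaternionAlgebra.re hconst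
      simp only [Quaternion.re_add, Quaternion.re_star] at h
      simp only [Quaternion.re_sub, Quaternion.re_coe]
      linarith
    · rw [qdiff_add hsm (smooth_star hsm), qdiff_star hsm]
      -- The inverse is a real multiple of the conjugate, so conjugation by α preserves imaginary
      -- quaternions.
      have h1 : (α q)⁻¹ = (Quaternion.normSq (α q))⁻¹ • star (α q) := rfl
      have h2 : star (qdiff fα q v) = -qdiff fα q v := by
        rw [hd, h1]
        simp only [star_mul, star_smul, star_add, star_star, star_trivial, hf.star_qdiff,
          smul_mul_assoc, mul_assoc, mul_smul_comm, add_mul, mul_add, neg_mul, mul_neg]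
        module
      rw [h2, add_neg_cancel]
  · intro p v
    have hθ : ∀ u, qdiff α p u = _ := fun u => hα.qdiff_eq hf.mean_curvature p u
    rw [hdc, one_smul, hodge, qdiff_gaugedNormal (θ := fun p => (1 / 2 : ℝ) •
        ((Real.cos s - 1) • qdiff f p (Complex.I * v) - Real.sin s • qdiff f p v))
        hc.smooth_left hα.1 hne (hθ v),
      qdiff_gaugedNormal (θ := fun p => (1 / 2 : ℝ) •
        ((Real.cos s - 1) • qdiff f p (Complex.I * (Complex.I * v))
          - Real.sin s • qdiff f p (Complex.I * v)))
        hc.smooth_left hα.1 hne (hθ _), gaugedNormal, conj_mul_conj (hinv p), hd, ← neg_mul,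
      ← mul_neg, ← sub_mul, ← mul_sub, ← smul_mul_assoc, ← mul_smul_comm]
    -- Both sides are conjugates by α; what remains is an identity between df, *df and *dN.
    congr 2
    rw [qdiff_I_I, hc.star, hf.mean_curvature.qdiff_normal p v]
    simp only [mul_add, mul_sub, sub_mul, mul_smul_comm, smul_mul_assoc, mul_assoc,
      hc.normal_anticomm, hc.normal_mul_normal, mul_neg, neg_mul, smul_neg]
    module

end CMC

section GaussMap

variable {X : Type*} [TopologicalSpace X] [ChartedSpace ℂ X] {f N : X → ℍ[ℝ]}

/-! ### The conformal Gauss map of a CMC surface -/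

/-- The conformal Gauss map of a surface with Gauss map `N` and mean curvature `1`. -/
noncomputable def gaussS (f N : X → ℍ[ℝ]) (p : X) : QMat :=
  !![N p + f p, -(N p * f p + f p * f p + f p * N p); 1, -(f p + N p)]

/-- Conformality and mean curvature see the surface only through its differential, so they hold for
f^α itself, whose real part need not vanish. -/
theorem IsCMC.of_sub_const {c : ℍ[ℝ]} (h : IsCMC (fun p => f p - c) N) :
    IsConformalImmersion f N N ∧ HasMeanCurvature f N fun _ => 1 := by
  have hs : Smooth f := by
    have := h.conformal.smooth.add (smooth_const c)
    simpa only [sub_add_cancel] using this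
  have hd : qdiff (fun p => f p - c) = qdiff f := by
    funext p v
    rw [qdiff_sub hs (smooth_const c), qdiff_const, sub_zero]
  have h1 := h.conformal
  have h2 := h.mean_curvature
  refine ⟨⟨hs, h1.smooth_left, h1.smooth_left, hd ▸ h1.immersion, h1.left_mem, h1.left_mem,
    hd ▸ h1.star_left, hd ▸ h1.star_right⟩, ?_⟩
  unfold HasMeanCurvature at h2 ⊢
  rwa [hd] at h2

/-- The parallel CMC surface `g = f + N` satisfies `*dg = -N dg`. -/
theorem normal_mul_parallel (hc : IsConformalImmersion f N N)
    (hH : HasMeanCurvature f N fun _ => 1) (p : X) (v : ℂ) :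
    N p * (qdiff f p v + qdiff N p v) =
      -(qdiff f p (Complex.I * v) + qdiff N p (Complex.I * v)) := by
  rw [hc.star, hH.qdiff_normal p (Complex.I * v), qdiff_I_I, hc.star]
  simp only [mul_add, mul_neg]
  module

/-- N anticommutes with df by conformality and with dN by differentiating N² = -1, hence with dg. -/
theorem parallel_mul_normal (hc : IsConformalImmersion f N N)
    (hH : HasMeanCurvature f N fun _ => 1) (p : X) (v : ℂ) :
    (qdiff f p v + qdiff N p v) * N p =
      qdiff f p (Complex.I * v) + qdiff N p (Complex.I * v) := by
  have h1 := qdiff_mul hc.smooth_left hc.smooth_left p v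
  have h2 : (fun q => N q * N q) = fun _ => -1 := funext fun q => (hc.left_mem q).2
  rw [h2, qdiff_const] at h1
  have h3 := normal_mul_parallel hc hH p v
  have h4 := hc.normal_anticomm p v
  linear_combination (norm := noncomm_ring) h4 - h1 - h3

theorem smooth_gaussS (hf : Smooth f) (hN : Smooth N) (i j : Fin 2) :
    Smooth fun p => gaussS f N p i j := by
  fin_cases i <;> fin_cases j
  · exact hN.add hf
  · exact (((hN.mul hf).add (hf.mul hf)).add (hf.mul hN)).neg
  · exact smooth_const 1
  · exact (hf.add hN).neg

theorem diffMat_gaussS (hc : IsConformalImmersion f N N) (p : X) (v : ℂ) :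
    diffMat (gaussS f N) p v = !![qdiff f p v + qdiff N p v,
      -((qdiff f p v + qdiff N p v) * f p + f p * (qdiff f p v + qdiff N p v));
      0, -(qdiff f p v + qdiff N p v)] := by
  have hf := hc.smooth
  have hN := hc.smooth_left
  refine Matrix.ext fun i j => ?_
  fin_cases i <;> fin_cases j
  · show qdiff (fun q => N q + f q) p v = _
    rw [qdiff_add hN hf, add_comm]; rfl
  · show qdiff (fun q => -(N q * f q + f q * f q + f q * N q)) p v =
      -((qdiff f p v + qdiff N p v) * f p + f p * (qdiff f p v + qdiff N p v))
    rw [qdiff_neg, qdiff_add ((hN.mul hf).add (hf.mul hf)) (hf.mul hN),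
      qdiff_add (hN.mul hf) (hf.mul hf), qdiff_mul hN hf, qdiff_mul hf hf, qdiff_mul hf hN,
      hc.normal_anticomm]
    noncomm_ring
  · exact qdiff_const 1 p v
  · show qdiff (fun q => -(f q + N q)) p v = -(qdiff f p v + qdiff N p v)
    rw [qdiff_neg, qdiff_add hf hN]

/-- The first column of the Hopf field is (f dg, dg)/4, since N dg = -*dg; η is exactly what cancels
it. Thus Â = F diag(0, -*dg/2) F⁻¹. -/
theorem hatA_gaussS (hc : IsConformalImmersion f N N) (hH : HasMeanCurvature f N fun _ => 1)
    (p : X) (v : ℂ) :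
    hatA f N (gaussS f N) p v =
      !![0, -((1 / 2 : ℝ) • (f p * (qdiff f p (Complex.I * v) + qdiff N p (Complex.I * v))));
        0, -((1 / 2 : ℝ) • (qdiff f p (Complex.I * v) + qdiff N p (Complex.I * v)))] := by
  have h1 := normal_mul_parallel hc hH p v
  have h1' : ∀ w, N p * ((qdiff f p v + qdiff N p v) * w) =
      -(qdiff f p (Complex.I * v) + qdiff N p (Complex.I * v)) * w := fun w => by
    rw [← mul_assoc, h1]
  rw [hatA, hopfField, hodge, diffMat_gaussS hc, diffMat_gaussS hc, cwEta,
    qdiff_add hc.smooth hc.smooth_left]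
  generalize qdiff f p v + qdiff N p v = G at *
  generalize qdiff f p (Complex.I * v) + qdiff N p (Complex.I * v) = G' at *
  unfold gaussS
  refine Matrix.ext fun i j => ?_
  fin_cases i <;> fin_cases j <;>
    simp [add_mul, mul_add, mul_assoc, h1, h1'] <;> module

theorem mem_quatLine_psi {x : ℍ[ℝ]} {w : Fin 2 → ℍ[ℝ]} : w ∈ quatLine (psi x) ↔ w 0 = x * w 1 := by
  constructor
  · rintro ⟨q, rfl⟩
    simp [psi]
  · intro h
    refine ⟨w 1, funext fun i => ?_⟩
    fin_cases i
    · simpa [psi] using h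
    · simp [psi]

theorem cwEta_mulVec_mem (f N : X → ℍ[ℝ]) (p : X) (v : ℂ) (w : Fin 2 → ℍ[ℝ]) :
    (cwEta f N p v).mulVec w ∈ lineBundle f p := by
  rw [lineBundle, mem_quatLine_psi, cwEta]
  simp [Matrix.mulVec, dotProduct, Fin.sum_univ_two, mul_assoc, mul_add]

/-- For the Hopf field condition, write A = Â - η: the columns of both terms are right multiples of
(f, 1). -/
theorem isConformalGaussMap_gaussS (hc : IsConformalImmersion f N N)
    (hH : HasMeanCurvature f N fun _ => 1) : IsConformalGaussMap f N (gaussS f N) := by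
  have hJ : ∀ p, (gaussS f N p).mulVec (psi (f p)) = fun i => -(psi (f p) i * N p) := by
    intro p
    funext i
    fin_cases i <;>
      simp [gaussS, psi, Matrix.mulVec, dotProduct, Fin.sum_univ_two, add_mul]
    abel
  have hline : ∀ p (q : ℍ[ℝ]), (gaussS f N p).mulVec (fun i => psi (f p) i * q) =
      fun i => psi (f p) i * -(N p * q) := by
    intro p q
    funext i
    have h := congrFun (hJ p) i
    simp only [Matrix.mulVec, dotProduct, ← mul_assoc] at h ⊢
    rw [← Finset.sum_mul, h]
    noncomm_ring
  refine ⟨smooth_gaussS hc.smooth hc.smooth_left, ?_, ?_, hJ, ?_, ?_⟩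
  · intro p
    have hN := (hc.left_mem p).2
    have hN' := hc.normal_mul_normal p
    refine Matrix.ext fun i j => ?_
    fin_cases i <;> fin_cases j <;>
      simp [gaussS, Matrix.mul_apply, Fin.sum_univ_two, mul_add, add_mul, mul_assoc, hN, hN']
    all_goals abel
  · intro p
    ext u
    constructor
    · rintro ⟨w, ⟨q, rfl⟩, rfl⟩
      exact ⟨_, hline p q⟩
    · rintro ⟨q, rfl⟩
      refine ⟨_, ⟨N p * q, rfl⟩, (hline p _).trans ?_⟩
      rw [hc.normal_mul_normal, neg_neg]
  · intro p v w hw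
    rw [lineBundle, mem_quatLine_psi] at hw ⊢
    rw [diffMat_gaussS hc]
    simp [Matrix.mulVec, dotProduct, Fin.sum_univ_two, hw, mul_add, add_mul, mul_assoc]
    abel
  · intro p v w
    have h1 := hatA_gaussS hc hH p v
    have h2 : hopfField (gaussS f N) p v = hatA f N (gaussS f N) p v - cwEta f N p v := by
      rw [hatA, add_sub_cancel_right]
    have h3 := cwEta_mulVec_mem f N p v w
    rw [lineBundle, mem_quatLine_psi] at h3 ⊢
    rw [h2, Matrix.sub_mulVec, Pi.sub_apply, Pi.sub_apply, h3, h1, mul_sub]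
    congr 1
    generalize qdiff f p (Complex.I * v) + qdiff N p (Complex.I * v) = G'
    simp [Matrix.mulVec, dotProduct, Fin.sum_univ_two, mul_assoc]

/-- The conformal Gauss map of a CMC surface is unique. -/
theorem IsConformalGaussMap.eq_gaussS (hc : IsConformalImmersion f N N)
    (hH : HasMeanCurvature f N fun _ => 1) {S : X → QMat} (hS : IsConformalGaussMap f N S) :
    S = gaussS f N := by
  have hf := hc.smooth
  have hN := hc.smooth_left
  have hS1 := hS.smooth
  -- The three conditions fix S in turn: Sψ = -ψN gives the second column in terms of the first,
  -- stability of L under dS gives the upper left entry, and the Hopf field gives the lower left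
  -- one.
  have e0 : ∀ p, S p 0 1 = -(f p * N p) - S p 0 0 * f p := fun p => by
    have h := congrFun (hS.eq_J p) 0
    simp [psi, Matrix.mulVec, dotProduct, Fin.sum_univ_two] at h
    rw [← h]; abel
  have e1 : ∀ p, S p 1 1 = -N p - S p 1 0 * f p := fun p => by
    have h := congrFun (hS.eq_J p) 1
    simp [psi, Matrix.mulVec, dotProduct, Fin.sum_univ_two] at h
    rw [← h]; abel
  have d0 : ∀ p v, diffMat S p v 0 1 = -(f p * qdiff N p v + qdiff f p v * N p) -
      (S p 0 0 * qdiff f p v + diffMat S p v 0 0 * f p) := fun p v => by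
    have : (fun q => S q 0 1) = fun q => -(f q * N q) - S q 0 0 * f q := funext e0
    show qdiff (fun q => S q 0 1) p v = _
    rw [this, qdiff_sub (hf.mul hN).neg ((hS1 0 0).mul hf), qdiff_neg, qdiff_mul hf hN,
      qdiff_mul (hS1 0 0) hf]
    rfl
  have d1 : ∀ p v, diffMat S p v 1 1 = -qdiff N p v -
      (S p 1 0 * qdiff f p v + diffMat S p v 1 0 * f p) := fun p v => by
    have : (fun q => S q 1 1) = fun q => -N q - S q 1 0 * f q := funext e1
    show qdiff (fun q => S q 1 1) p v = _
    rw [this, qdiff_sub hN.neg ((hS1 1 0).mul hf), qdiff_neg, qdiff_mul (hS1 1 0) hf]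
    rfl
  have hne : ∀ p, qdiff f p 1 ≠ 0 := fun p h0 => by
    have h1 : (1 : ℂ) = 0 :=
      hc.immersion p (h0.trans (map_zero (mfderiv 𝓘(ℝ, ℂ) 𝓘(ℝ, ℍ[ℝ]) f p)).symm)
    exact one_ne_zero h1
  have a0 : ∀ p, S p 0 0 = N p + f p * S p 1 0 := fun p => by
    have h := hS.diff_line p 1 (psi (f p)) ⟨1, by simp⟩
    rw [lineBundle, mem_quatLine_psi] at h
    simp [psi, Matrix.mulVec, dotProduct, Fin.sum_univ_two, d0, d1] at h
    refine mul_right_cancel₀ (hne p) ?_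
    have hx := hc.normal_anticomm p 1
    linear_combination (norm := noncomm_ring) -h - hx
  have b0 : ∀ p v, diffMat S p v 0 0 = qdiff N p v + (f p * diffMat S p v 1 0 +
      qdiff f p v * S p 1 0) := fun p v => by
    have : (fun q => S q 0 0) = fun q => N q + f q * S q 1 0 := funext a0
    show qdiff (fun q => S q 0 0) p v = _
    rw [this, qdiff_add hN (hf.mul (hS1 1 0)), qdiff_mul hf (hS1 1 0)]
    rfl
  have hq : ∀ p, S p 1 0 = 1 := fun p => by
    have h := hS.hopf_line p 1 ![1, 0]
    rw [lineBundle, mem_quatLine_psi] at h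
    have hx := hc.star p 1
    have hsn := hH.qdiff_normal p (Complex.I * 1)
    rw [qdiff_I_I, mul_neg] at hsn
    simp only [Matrix.mulVec, dotProduct, Fin.sum_univ_two, hopfField, Matrix.smul_apply,
      Matrix.cons_val_zero, Matrix.cons_val_one, mul_zero, add_zero, mul_one, mul_smul_comm] at h
    have h' := smul_right_injective ℍ[ℝ] (by norm_num : (1 / 4 : ℝ) ≠ 0) h
    simp only [Matrix.add_apply, Matrix.mul_apply, Fin.sum_univ_two, hodge, e0, e1, a0, b0] at h'
    have hy : qdiff f p (Complex.I * 1) ≠ 0 := by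
      rw [hx]
      refine mul_ne_zero (fun h0 => ?_) (hne p)
      have := (hc.left_mem p).2
      rw [h0, mul_zero] at this
      exact one_ne_zero (neg_eq_zero.1 this.symm)
    rw [two_smul] at hsn
    have hxq : qdiff f p (Complex.I * 1) * S p 1 0 = N p * qdiff f p 1 * S p 1 0 := by rw [hx]
    -- Applied to (1, 0), the Hopf field condition becomes 2 *df (S₁₀ - 1) = 0; the mean curvature
    -- equation `hsn` is the source of the 1.
    have hz : (2 : ℝ) • (qdiff f p (Complex.I * 1) * (S p 1 0 - 1)) = 0 := by
      rw [two_smul]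
      linear_combination (norm := noncomm_ring) h' - hsn + hxq
    have hz' := (smul_eq_zero.1 hz).resolve_left two_ne_zero
    exact sub_eq_zero.1 ((mul_eq_zero.1 hz').resolve_left hy)
  funext p
  refine Matrix.ext fun i j => ?_
  fin_cases i <;> fin_cases j
  · simp [gaussS, a0, hq]
  · simp [gaussS, e0, a0, hq, add_mul]; abel
  · simp [gaussS, hq]
  · simp [gaussS, e1, hq]; abel

/-! ### Parallel frames -/

/-- The form of Â decouples the system: the second component solves the equation of a
d^N_lam-parallel section with g in place of f, and the first is then a quadrature. -/
theorem connS_gaussS (hc : IsConformalImmersion f N N) (hH : HasMeanCurvature f N fun _ => 1)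
    {lam : ℂ} (hlam : ‖lam‖ = 1) (φ : X → Fin 2 → ℍ[ℝ]) (p : X) (v : ℂ) :
    connS f N (gaussS f N) lam φ p v = 0 ↔
      qdiff (fun q => φ q 0) p v = f p * qdiff (fun q => φ q 1) p v ∧
      qdiff (fun q => φ q 1) p v = ((1 / 2 : ℝ) • ((lam.re - 1) •
        (qdiff f p (Complex.I * v) + qdiff N p (Complex.I * v)) -
        lam.im • (qdiff f p v + qdiff N p v))) * φ p 1 := by
  have h1 : connS f N (gaussS f N) lam φ p v = 0 ↔
      (connS f N (gaussS f N) lam φ p v 0 = 0 ∧ connS f N (gaussS f N) lam φ p v 1 = 0) := by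
    rw [funext_iff, Fin.forall_fin_two]; rfl
  rw [h1]
  simp only [connS, hodge, hatA_gaussS hc hH, qdiff_I_I, spectralPart_of_norm_eq_one hlam,
    Pi.add_apply, diffVec]
  simp only [Matrix.mulVec, dotProduct, Fin.sum_univ_two, Matrix.of_apply, Matrix.cons_val',
    Matrix.cons_val_zero, Matrix.cons_val_one, Matrix.cons_val_fin_one, zero_mul, zero_add]
  generalize qdiff f p (Complex.I * v) + qdiff N p (Complex.I * v) = G'
  have hneg : -qdiff f p v + -qdiff N p v = -(qdiff f p v + qdiff N p v) := by abel
  rw [hneg]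
  generalize qdiff f p v + qdiff N p v = G
  generalize qdiff (fun q => φ q 0) p v = a
  generalize qdiff (fun q => φ q 1) p v = b
  have e1 : b + ((lam.re - 1) • (-((1 / 2 : ℝ) • G') * φ p 1) +
      lam.im • (-((1 / 2 : ℝ) • -G) * φ p 1)) = b - ((1 / 2 : ℝ) • ((lam.re - 1) • G' -
        lam.im • G)) * φ p 1 := by
    simp only [smul_mul_assoc, neg_mul, sub_mul, smul_neg]
    module
  have e0 : a + ((lam.re - 1) • (-((1 / 2 : ℝ) • (f p * G')) * φ p 1) +
      lam.im • (-((1 / 2 : ℝ) • (f p * -G)) * φ p 1)) = a - f p * (((1 / 2 : ℝ) •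
        ((lam.re - 1) • G' - lam.im • G)) * φ p 1) := by
    simp only [smul_mul_assoc, neg_mul, sub_mul, smul_neg, mul_neg, mul_assoc, mul_sub,
      mul_smul_comm]
    module
  rw [e0, e1, sub_eq_zero, sub_eq_zero]
  constructor
  · rintro ⟨h0, h2⟩; exact ⟨h2 ▸ h0, h2⟩
  · rintro ⟨h0, h2⟩; exact ⟨h2 ▸ h0, h2⟩

/-- The invertible matrix `(1 u; 0 w)`. -/
noncomputable def upperUnit (u w : ℍ[ℝ]) (hw : w ≠ 0) : QGL where
  val := !![1, u; 0, w]
  inv := !![1, -(u * w⁻¹); 0, w⁻¹]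
  val_inv := by
    refine Matrix.ext fun i j => ?_
    fin_cases i <;> fin_cases j <;> simp [Matrix.mul_apply, Fin.sum_univ_two, hw]
  inv_val := by
    refine Matrix.ext fun i j => ?_
    fin_cases i <;> fin_cases j <;> simp [Matrix.mul_apply, Fin.sum_univ_two, hw]

theorem moebius_mul (m n : QGL) (ℓ : Set (Fin 2 → ℍ[ℝ])) :
    moebius (m * n) ℓ = moebius m (moebius n ℓ) := by
  simp only [moebius, Set.image_image, Units.val_mul, Matrix.mulVec_mulVec]

theorem moebius_quatLine (m : QGL) {w w' : Fin 2 → ℍ[ℝ]} {q : ℍ[ℝ]} (hq : q ≠ 0)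
    (h : ∀ i, (m : QMat).mulVec w i = w' i * q) : moebius m (quatLine w) = quatLine w' := by
  have hmul : ∀ r : ℍ[ℝ], (m : QMat).mulVec (fun i => w i * r) = fun i => w' i * (q * r) := by
    intro r
    funext i
    rw [← mul_assoc, ← h i]
    simp only [Matrix.mulVec, dotProduct, Finset.sum_mul, mul_assoc]
  ext u
  constructor
  · rintro ⟨_, ⟨r, rfl⟩, rfl⟩
    exact ⟨q * r, hmul r⟩
  · rintro ⟨r, rfl⟩
    refine ⟨_, ⟨q⁻¹ * r, rfl⟩, (hmul _).trans ?_⟩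
    rw [← mul_assoc q, mul_inv_cancel₀ hq, one_mul]

/-- Every parallel frame is obtained from `F (1 x; 0 y)`, where `dx = -df y`, by a constant. -/
theorem frame_const [IsManifold 𝓘(ℂ, ℂ) ω X] [PreconnectedSpace X]
    (hc : IsConformalImmersion f N N) (hH : HasMeanCurvature f N fun _ => 1)
    {lam : ℂ} (hlam : ‖lam‖ = 1) {x y : X → ℍ[ℝ]} (hx : Smooth x) (hy : Smooth y)
    (hy0 : ∀ p, y p ≠ 0) (hdx : ∀ p v, qdiff x p v = -(qdiff f p v * y p))
    (hdy : ∀ p v, qdiff y p v = ((1 / 2 : ℝ) • ((lam.re - 1) •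
        (qdiff f p (Complex.I * v) + qdiff N p (Complex.I * v)) -
        lam.im • (qdiff f p v + qdiff N p v))) * y p)
    {Φ : X → QGL} (hΦ : IsParallelFrame f N (gaussS f N) lam Φ) (p q : X) :
    (upperUnit (x p + f p * y p) (y p) (hy0 p))⁻¹ * Φ p =
      (upperUnit (x q + f q * y q) (y q) (hy0 q))⁻¹ * Φ q := by
  -- Two solutions of the same equation dy = ωy, one nowhere zero, differ by a constant right
  -- factor.
  have h1 : ∀ (j : Fin 2) (p q : X), (y p)⁻¹ * (Φ p : QMat) 1 j = (y q)⁻¹ * (Φ q : QMat) 1 j := by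
    intro j
    have hs := (hΦ j).1 1
    refine Smooth.eq_of_qdiff_eq_zero ((hy.inv hy0).mul hs) fun p v => ?_
    rw [qdiff_mul (hy.inv hy0) hs, qdiff_inv hy hy0, hdy,
      ((connS_gaussS hc hH hlam _ p v).1 ((hΦ j).2 p v)).2]
    simp only [mul_assoc, mul_inv_cancel_left₀ (hy0 p), neg_mul]
    abel
  have h0 : ∀ (j : Fin 2) (p q : X),
      (Φ p : QMat) 0 j - f p * (Φ p : QMat) 1 j - x p * ((y p)⁻¹ * (Φ p : QMat) 1 j) =
      (Φ q : QMat) 0 j - f q * (Φ q : QMat) 1 j - x q * ((y q)⁻¹ * (Φ q : QMat) 1 j) := by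
    intro j p q
    rw [h1 j p q]
    -- This constant factor is frozen at `q`; then φ₀ - fφ₁ - xk has differential -df φ₁ + df y k =
    -- 0.
    set k := (y q)⁻¹ * (Φ q : QMat) 1 j with hk
    have hs0 : Smooth fun p => (Φ p : QMat) 0 j := (hΦ j).1 0
    have hs1 : Smooth fun p => (Φ p : QMat) 1 j := (hΦ j).1 1
    have he : ∀ p v, qdiff (fun p => (Φ p : QMat) 0 j) p v =
        f p * qdiff (fun p => (Φ p : QMat) 1 j) p v := fun p v =>
      ((connS_gaussS hc hH hlam _ p v).1 ((hΦ j).2 p v)).1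
    refine Smooth.eq_of_qdiff_eq_zero
      (h := fun p => (Φ p : QMat) 0 j - f p * (Φ p : QMat) 1 j - x p * k)
      ((hs0.sub (hc.smooth.mul hs1)).sub (hx.mul (smooth_const k))) (fun p v => ?_) p q
    have hkp : (Φ p : QMat) 1 j = y p * k := by
      rw [hk, ← h1 j p q, mul_inv_cancel_left₀ (hy0 p)]
    rw [qdiff_sub (hs0.sub (hc.smooth.mul hs1)) (hx.mul (smooth_const k)),
      qdiff_sub hs0 (hc.smooth.mul hs1), qdiff_mul hc.smooth hs1, qdiff_mul hx (smooth_const k),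
      qdiff_const, hdx, he, hkp]
    noncomm_ring
  have key : ∀ p, (((upperUnit (x p + f p * y p) (y p) (hy0 p))⁻¹ * Φ p : QGL) : QMat) =
      Matrix.of ![fun j => (Φ p : QMat) 0 j - f p * (Φ p : QMat) 1 j -
        x p * ((y p)⁻¹ * (Φ p : QMat) 1 j), fun j => (y p)⁻¹ * (Φ p : QMat) 1 j] := by
    intro p
    have e : (((upperUnit (x p + f p * y p) (y p) (hy0 p))⁻¹ : QGL) : QMat) =
      !![1, -((x p + f p * y p) * (y p)⁻¹); 0, (y p)⁻¹] := rfl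
    rw [Units.val_mul, e]
    refine Matrix.ext fun i j => ?_
    fin_cases i
    · simp [Matrix.mul_apply, Fin.sum_univ_two, add_mul, mul_assoc, mul_inv_cancel_left₀ (hy0 p)]
      abel
    · simp [Matrix.mul_apply, Fin.sum_univ_two]
  refine Units.ext ?_
  rw [key, key]
  refine Matrix.ext fun i j => ?_
  fin_cases i
  · exact h0 j p q
  · exact h1 j p q

/-- From a parallel section `β` of `d^N_lam` one obtains explicitly a `d^S_lam`-parallel frame, and
the corresponding surface. -/
theorem frame_of_parallel [IsManifold 𝓘(ℂ, ℂ) ω X] [PreconnectedSpace X] [Nonempty X]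
    (hc : IsConformalImmersion f N N)
    (hH : HasMeanCurvature f N fun _ => 1) {lam : ℂ} (hlam : ‖lam‖ = 1) (hre : 0 < lam.re)
    (him : lam.im ≠ 0) {β : X → ℍ[ℝ]} (hβ : Smooth β) (hβ0 : ∀ p, β p ≠ 0)
    (hdβ : ∀ p v, qdiff β p v = ((1 / 2 : ℝ) • ((lam.re - 1) • qdiff f p (Complex.I * v) -
      lam.im • qdiff f p v)) * β p) :
    (∃ Φ, IsParallelFrame f N (gaussS f N) lam Φ) ∧
    ∀ Φ, IsParallelFrame f N (gaussS f N) lam Φ → ∃ m : QGL, ∀ p,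
      moebius m (cwAssociated f Φ p) = quatLine (psi (-((2 / lam.im) • (β p - 1)))) := by
  set a := lam.re with ha
  set b := lam.im with hb
  have hab : a ^ 2 + b ^ 2 = 1 := by
    have := Complex.sq_norm lam
    rw [hlam, Complex.normSq_apply] at this
    nlinarith
  have ha1 : (1 + a) ≠ 0 := by positivity
  -- With lam = exp(it) this is tan(t/2), characterised by kb = 1 - a and k(1 + a) = b.
  set k := b / (1 + a) with hk
  have hk1 : k * b = 1 - a := by
    rw [hk]; field_simp; nlinarith
  have hk2 : k * (1 + a) = b := by rw [hk]; field_simp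
  have hN := hc.smooth_left
  -- As N anticommutes with df, dβ = -(b/2) df (1 - kN)β. Hence y = (1 - kN)β has the primitive x of
  -- -df y in closed form.
  set x : X → ℍ[ℝ] := fun p => (2 / b) • β p with hx
  set y : X → ℍ[ℝ] := fun p => β p - k • (N p * β p) with hy
  have hxs : Smooth x := hβ.smul _
  have hys : Smooth y := hβ.sub ((hN.mul hβ).smul k)
  have hfac : ∀ p, y p = (1 - k • N p) * β p := fun p => by
    simp only [hy, sub_mul, one_mul, smul_mul_assoc]
  have hy0 : ∀ p, y p ≠ 0 := by
    -- The factor 1 - kN has real part 1, so it cannot vanish.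
    intro p
    rw [hfac]
    refine mul_ne_zero (fun h => ?_) (hβ0 p)
    have h1 := congrArg QuaternionAlgebra.re h
    simp [(hc.left_mem p).1] at h1
  have hdx : ∀ p v, qdiff x p v = -(qdiff f p v * y p) := by
    intro p v
    rw [hx, qdiff_smul _ hβ, hdβ, hfac, hc.star]
    have hbb : a - 1 = -(k * b) := by rw [hk1]; ring
    rw [hbb]
    simp only [mul_sub, sub_mul, smul_mul_assoc, mul_smul_comm, mul_one, ← mul_assoc,
      hc.normal_anticomm, neg_mul]
    match_scalars <;> field_simp
  have hdy : ∀ p v, qdiff y p v = ((1 / 2 : ℝ) • ((a - 1) •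
        (qdiff f p (Complex.I * v) + qdiff N p (Complex.I * v)) -
        b • (qdiff f p v + qdiff N p v))) * y p := by
    intro p v
    rw [hfac, hy, qdiff_sub hβ ((hN.mul hβ).smul k), qdiff_smul _ (hN.mul hβ), qdiff_mul hN hβ, hdβ]
    -- Both sides of the equation for y equal -k dg β; `hL` and `hR` compute the two coefficients of
    -- β.
    have hL : (1 / 2 : ℝ) • ((a - 1) • qdiff f p (Complex.I * v) - b • qdiff f p v) -
        k • (N p * ((1 / 2 : ℝ) • ((a - 1) • qdiff f p (Complex.I * v) - b • qdiff f p v)) +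
          qdiff N p v) = -(k • (qdiff f p v + qdiff N p v)) := by
      rw [hc.star]
      simp only [mul_smul_comm, mul_sub, hc.normal_mul_normal]
      linear_combination (norm := module) ((1 / 2 : ℝ) * hk1) • (N p * qdiff f p v) +
        ((1 / 2 : ℝ) * hk2) • qdiff f p v
    have hR : ((1 / 2 : ℝ) • ((a - 1) •
        (qdiff f p (Complex.I * v) + qdiff N p (Complex.I * v)) -
        b • (qdiff f p v + qdiff N p v))) * (1 - k • N p) =
        -(k • (qdiff f p v + qdiff N p v)) := by
      have h1 := parallel_mul_normal hc hH p v
      have h2 := parallel_mul_normal hc hH p (Complex.I * v)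
      rw [qdiff_I_I, qdiff_I_I] at h2
      simp only [smul_mul_assoc, mul_sub, sub_mul, mul_smul_comm, mul_one, h1, h2]
      linear_combination (norm := module)
        ((1 / 2 : ℝ) * hk1) • (qdiff f p (Complex.I * v) + qdiff N p (Complex.I * v)) +
        ((1 / 2 : ℝ) * hk2) • (qdiff f p v + qdiff N p v)
    refine Eq.trans ?_ (mul_assoc _ _ _)
    rw [hR, ← hL]
    simp only [sub_mul, add_mul, smul_mul_assoc, mul_assoc]
  set Φ₀ : X → QGL := fun p => upperUnit (x p + f p * y p) (y p) (hy0 p) with hΦ₀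
  constructor
  · refine ⟨Φ₀, fun j => ?_⟩
    fin_cases j
    · refine ⟨fun i => ?_, fun p v => ?_⟩
      · fin_cases i
        · exact smooth_const 1
        · exact smooth_const 0
      · rw [connS_gaussS hc hH hlam]
        have e0 : qdiff (fun q => (Φ₀ q : QMat) 0 0) p v = 0 := qdiff_const 1 p v
        have e1 : qdiff (fun q => (Φ₀ q : QMat) 1 0) p v = 0 := qdiff_const 0 p v
        have e2 : (Φ₀ p : QMat) 1 0 = 0 := rfl
        simp only [Fin.zero_eta]
        rw [e0, e1, e2]; simp
    · refine ⟨fun i => ?_, fun p v => ?_⟩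
      · fin_cases i
        · exact hxs.add (hc.smooth.mul hys)
        · exact hys
      · rw [connS_gaussS hc hH hlam]
        have e0 : qdiff (fun q => (Φ₀ q : QMat) 0 1) p v = f p * qdiff y p v := by
          have := qdiff_add hxs (hc.smooth.mul hys) p v
          rw [hdx, qdiff_mul hc.smooth hys] at this
          exact this.trans (by abel)
        exact ⟨e0, hdy p v⟩
  · intro Φ hΦ
    obtain ⟨p₀⟩ := ‹Nonempty X›
    -- The constant matrix `(Φ₀ p₀)⁻¹ * Φ p₀` replaces Φ by Φ₀, and the translation by 2/b removes
    -- the pole of -(2/b)β at b = 0.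
    refine ⟨upperUnit (2 / b : ℝ) 1 one_ne_zero * ((Φ₀ p₀)⁻¹ * Φ p₀), fun p => ?_⟩
    have hconst := frame_const hc hH hlam hxs hys hy0 hdx hdy hΦ p₀ p
    rw [hconst, cwAssociated, ← moebius_mul]
    have e : upperUnit (2 / b : ℝ) 1 one_ne_zero * ((Φ₀ p)⁻¹ * Φ p) * (Φ p)⁻¹ =
        upperUnit (2 / b : ℝ) 1 one_ne_zero * (Φ₀ p)⁻¹ := by group
    rw [show (upperUnit (x p + f p * y p) (y p) (hy0 p)) = Φ₀ p from rfl, e, moebius_mul]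
    -- Indeed Φ₀⁻¹ψ = (-x, 1) y⁻¹.
    have e1 : moebius (Φ₀ p)⁻¹ (lineBundle f p) = quatLine (psi (-x p)) := by
      refine moebius_quatLine _ (inv_ne_zero (hy0 p)) fun i => ?_
      have e2 : (((Φ₀ p)⁻¹ : QGL) : QMat) =
        !![1, -((x p + f p * y p) * (y p)⁻¹); 0, (y p)⁻¹] := rfl
      rw [e2]
      fin_cases i
      · simp [psi, Matrix.mulVec, dotProduct, Fin.sum_univ_two, add_mul, mul_assoc,
          mul_inv_cancel₀ (hy0 p)]
      · simp [psi, Matrix.mulVec, dotProduct, Fin.sum_univ_two]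
    rw [e1]
    refine moebius_quatLine _ one_ne_zero fun i => ?_
    have e3 : ((upperUnit (2 / b : ℝ) 1 one_ne_zero : QGL) : QMat) =
      !![1, ((2 / b : ℝ) : ℍ[ℝ]); 0, 1] := rfl
    rw [e3]
    fin_cases i
    · simp only [psi, Matrix.mulVec, dotProduct, Fin.sum_univ_two, hx]
      simp only [Matrix.of_apply, Fin.zero_eta, Matrix.cons_val', Matrix.cons_val_zero,
        Matrix.cons_val_one, Matrix.cons_val_fin_one, one_mul, mul_one]
      rw [smul_sub, ← Quaternion.coe_mul_eq_smul (2 / b) 1, mul_one]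
      abel
    · simp [psi, Matrix.mulVec, dotProduct, Fin.sum_univ_two]

end GaussMap

/-! ### Limits on the unit circle -/

theorem continuous_circle_coe : Continuous fun lam : Circle => (lam : ℂ) :=
  continuous_induced_dom

theorem eventually_circle_re_pos : ∀ᶠ lam : Circle in 𝓝[≠] 1, 0 < (lam : ℂ).re := by
  have h : Tendsto (fun lam : Circle => (lam : ℂ).re) (𝓝 1) (𝓝 1) := by
    have := (Complex.continuous_re.comp continuous_circle_coe).tendsto (1 : Circle)
    simpa [Function.comp_def] using this
  exact (h.mono_left nhdsWithin_le_nhds).eventually (lt_mem_nhds one_pos)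

theorem eventually_circle_im_ne_zero : ∀ᶠ lam : Circle in 𝓝[≠] 1, (lam : ℂ).im ≠ 0 := by
  filter_upwards [eventually_circle_re_pos, eventually_mem_nhdsWithin] with lam hre hne him
  refine hne (Circle.ext (Complex.ext ?_ him))
  have h := lam.normSq_coe
  rw [Complex.normSq_apply, him] at h
  show (lam : ℂ).re = 1
  nlinarith

theorem circle_re_eq_cos_arg (lam : Circle) : (lam : ℂ).re = Real.cos (Complex.arg lam) := by
  conv_lhs => rw [← Circle.exp_arg lam, Circle.coe_exp, Complex.exp_ofReal_mul_I_re]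

theorem circle_im_eq_sin_arg (lam : Circle) : (lam : ℂ).im = Real.sin (Complex.arg lam) := by
  conv_lhs => rw [← Circle.exp_arg lam, Circle.coe_exp, Complex.exp_ofReal_mul_I_im]

/-- Justifies the substitution lam = exp(it) with t → 0 and t ≠ 0. -/
theorem tendsto_circle_arg :
    Tendsto (fun lam : Circle => Complex.arg (lam : ℂ)) (𝓝[≠] 1) (𝓝[≠] 0) := by
  refine tendsto_nhdsWithin_iff.2 ⟨?_, ?_⟩
  · have h1 : ContinuousAt Complex.arg ((1 : Circle) : ℂ) :=
      Complex.continuousAt_arg (by simp)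
    have h2 := (h1.comp (f := fun lam : Circle => (lam : ℂ))
      continuous_circle_coe.continuousAt).tendsto
    simp only [Function.comp_def, Circle.coe_one, Complex.arg_one] at h2
    exact h2.mono_left nhdsWithin_le_nhds
  · filter_upwards [eventually_circle_im_ne_zero] with lam him h0
    rw [circle_im_eq_sin_arg, Set.mem_singleton_iff.1 h0, Real.sin_zero] at him
    exact him rfl

theorem tendsto_self_div_sin : Tendsto (fun t : ℝ => t / Real.sin t) (𝓝[≠] 0) (𝓝 1) := by
  have h := (hasDerivAt_iff_tendsto_slope.1 (Real.hasDerivAt_sin 0)).inv₀ (by simp)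
  rw [Real.cos_zero, inv_one] at h
  refine h.congr fun t => ?_
  simp [slope_def_field]

/-! ### The limit of the constrained Willmore associated family -/

theorem associated_limit {X : Type*} [TopologicalSpace X] [ConnectedSpace X] [ChartedSpace ℂ X]
    [IsManifold 𝓘(ℂ, ℂ) ω X] {f N : X → ℍ[ℝ]} (hf : IsCMC f N) {s : ℝ} {α : X → ℍ[ℝ]}
    (hα : IsParallelN N (Complex.exp (s * Complex.I)) α) (hα_ne : α ≠ 0)
    {fα : X → ℍ[ℝ]} (hfα : IsAssociatedCMC N s α fα) :
    (∃ c : ℝ, IsCMC (fun p => fα p - (c : ℍ[ℝ])) (gaugedNormal N α)) ∧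
    (∃ S : X → QMat, IsConformalGaussMap fα (gaugedNormal N α) S) ∧
    ∀ S : X → QMat, IsConformalGaussMap fα (gaugedNormal N α) S →
      (∀ᶠ lam : Circle in 𝓝[≠] 1, ∃ Φ : X → QGL,
        IsParallelFrame fα (gaugedNormal N α) S (lam : ℂ) Φ) ∧
      ∀ Φ : Circle → X → QGL,
        (∀ᶠ lam : Circle in 𝓝[≠] 1,
          IsParallelFrame fα (gaugedNormal N α) S (lam : ℂ) (Φ lam)) →
        ∃ (m : Circle → QGL) (fΦ : Circle → X → ℍ[ℝ]),
          (∀ᶠ lam : Circle in 𝓝[≠] 1, ∀ p : X,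
            moebius (m lam) (cwAssociated fα (Φ lam) p) = lineBundle (fΦ lam) p) ∧
          TendstoLocallyUniformly fΦ fα (𝓝[≠] 1) := by
  obtain ⟨αt, ⟨hαs, ε, hε0, hε, hpar⟩, hfα⟩ := hfα
  obtain ⟨p₀, hp₀⟩ := Function.ne_iff.1 hα_ne
  have hne : ∀ p, α p ≠ 0 := hα.ne_zero hf hp₀
  have hs : s ∈ Set.Ioo (s - ε) (s + ε) := ⟨by linarith, by linarith⟩
  obtain ⟨hsm, hd⟩ := qdiff_symBobenko hf.mean_curvature hε0 hε hpar (hαs ▸ hne)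
    (fα := fα) (fun p => by rw [hαs]; exact hfα p)
  simp only [hαs] at hd
  have hcmc := gaugedNormal_isCMC hf hα hne hsm hd p₀
  obtain ⟨hc, hH⟩ := hcmc.of_sub_const
  refine ⟨⟨_, hcmc⟩, ⟨_, isConformalGaussMap_gaussS hc hH⟩, fun S hS => ?_⟩
  rw [hS.eq_gaussS hc hH]
  obtain ⟨-, hder, -, hlim⟩ := family_deriv hε0 hε (fun t ht => (hpar t ht).1)
  -- The quotient of two members of the family for f is parallel for f^α with parameter lam: by the
  -- addition formulas, the angles s and arg lam add up.
  set β : Circle → X → ℍ[ℝ] := fun lam p => (α p)⁻¹ * αt (s + Complex.arg (lam : ℂ)) p with hβ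
  have hshift : Tendsto (fun lam : Circle => s + Complex.arg (lam : ℂ)) (𝓝[≠] 1) (𝓝 s) := by
    have := (tendsto_circle_arg.mono_right nhdsWithin_le_nhds).const_add s
    rwa [add_zero] at this
  have hIoo : ∀ᶠ lam : Circle in 𝓝[≠] 1,
      s + Complex.arg (lam : ℂ) ∈ Set.Ioo (s - ε) (s + ε) :=
    hshift.eventually (Ioo_mem_nhds hs.1 hs.2)
  -- One point suffices, since a parallel section that is non-zero somewhere is non-zero everywhere.
  have hne' : ∀ᶠ lam : Circle in 𝓝[≠] 1, αt (s + Complex.arg (lam : ℂ)) p₀ ≠ 0 := by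
    have h1 := (hder p₀).continuousAt.tendsto.comp hshift
    refine h1.eventually (isOpen_ne.mem_nhds ?_)
    rw [hαs]; exact hp₀
  have hframe : ∀ᶠ lam : Circle in 𝓝[≠] 1,
      (∃ Φ, IsParallelFrame fα (gaugedNormal N α) (gaussS fα (gaugedNormal N α)) lam Φ) ∧
      ∀ Φ, IsParallelFrame fα (gaugedNormal N α) (gaussS fα (gaugedNormal N α)) lam Φ →
        ∃ m : QGL, ∀ p, moebius m (cwAssociated fα Φ p) =
          quatLine (psi (-((2 / (lam : ℂ).im) • (β lam p - 1)))) := by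
    filter_upwards [eventually_circle_re_pos, eventually_circle_im_ne_zero, hIoo, hne'] with
      lam hre him hmem hnz
    have hαt := hpar _ hmem
    refine frame_of_parallel hc hH (Circle.norm_coe lam) hre him (β := β lam)
      ((hα.1.inv hne).mul hαt.1)
      (fun p => mul_ne_zero (inv_ne_zero (hne p)) (hαt.ne_zero hf hnz p)) fun p v => ?_
    rw [hβ, qdiff_mul (hα.1.inv hne) hαt.1, qdiff_inv hα.1 hne,
      hαt.qdiff_eq hf.mean_curvature, hα.qdiff_eq hf.mean_curvature, hd, hd, qdiff_I_I,
      circle_re_eq_cos_arg, circle_im_eq_sin_arg, Real.cos_add, Real.sin_add]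
    have h2 : ∀ w, α p * ((α p)⁻¹ * w) = w := fun w => by
      rw [← mul_assoc, mul_inv_cancel₀ (hne p), one_mul]
    simp only [mul_add, add_mul, mul_sub, sub_mul, smul_mul_assoc, mul_smul_comm, mul_assoc, h2,
      neg_mul, mul_neg]
    module
  refine ⟨hframe.mono fun lam h => h.1, fun Φ hΦ => ?_⟩
  have hm : ∀ lam : Circle, ∃ m : QGL, (∃ m' : QGL, ∀ p,
      moebius m' (cwAssociated fα (Φ lam) p) =
        quatLine (psi (-((2 / (lam : ℂ).im) • (β lam p - 1))))) →
      ∀ p, moebius m (cwAssociated fα (Φ lam) p) =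
        quatLine (psi (-((2 / (lam : ℂ).im) • (β lam p - 1)))) := fun lam => by
    by_cases h : ∃ m' : QGL, ∀ p, moebius m' (cwAssociated fα (Φ lam) p) =
        quatLine (psi (-((2 / (lam : ℂ).im) • (β lam p - 1))))
    · exact ⟨h.choose, fun _ => h.choose_spec⟩
    · exact ⟨1, fun h' => absurd h' h⟩
  choose m hm using hm
  refine ⟨m, fun lam p => -((2 / (lam : ℂ).im) • (β lam p - 1)), ?_, ?_⟩
  · filter_upwards [hframe, hΦ] with lam h1 h2
    exact hm lam (h1.2 _ h2)
  · rw [tendstoLocallyUniformly_iff_forall_tendsto]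
    intro x
    refine Tendsto.mono_right ?_ (nhds_le_uniformity (fα x))
    rw [nhds_prod_eq]
    refine Tendsto.prodMk (hsm.continuous.continuousAt.tendsto.comp tendsto_snd) ?_
    have h1 := (hlim x).comp (tendsto_circle_arg.prodMap (tendsto_id (α := X) (x := 𝓝 x)))
    have h2 : Tendsto (fun z : Circle × X => (Complex.arg (z.1 : ℂ) /
        Real.sin (Complex.arg (z.1 : ℂ)))) (𝓝[≠] 1 ×ˢ 𝓝 x) (𝓝 1) :=
      tendsto_self_div_sin.comp (tendsto_circle_arg.comp tendsto_fst)
    have h3 : Tendsto (fun z : Circle × X => (-2 : ℝ) • (α z.2)⁻¹) (𝓝[≠] 1 ×ˢ 𝓝 x)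
        (𝓝 ((-2 : ℝ) • (α x)⁻¹)) :=
      (((hα.1.inv hne).smul (-2)).continuous.continuousAt.tendsto).comp tendsto_snd
    -- With t = arg lam, the surface factors as -2α⁻¹ times t/sin t times the difference quotient of
    -- α(·) at s.
    have h4 := h3.mul (h2.smul h1)
    have e : (-2 : ℝ) • (α x)⁻¹ * (1 : ℝ) • deriv (fun t => αt t x) s = fα x := by
      rw [hfα x, one_smul, ← Quaternion.coe_mul_eq_smul]
      push_cast
      rfl
    rw [e] at h4
    refine h4.congr' ?_
    have hne0 : ∀ᶠ z : Circle × X in 𝓝[≠] 1 ×ˢ 𝓝 x, Complex.arg (z.1 : ℂ) ≠ 0 :=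
      tendsto_fst.eventually (tendsto_circle_arg.eventually eventually_mem_nhdsWithin)
    filter_upwards [hne0] with z hz
    simp only [Function.comp_apply, Prod.map_fst, Prod.map_snd, id_eq, hβ, hαs,
      circle_im_eq_sin_arg, smul_smul, smul_mul_assoc, mul_smul_comm, mul_sub,
      inv_mul_cancel₀ (hne z.2)]
    match_scalars <;> field_simp

end CMCFamily

open CMCFamily
theorem mainTheorem7
    {M : Type*} [TopologicalSpace M] [T2Space M] [ConnectedSpace M]
    [ChartedSpace ℂ M] [IsManifold 𝓘(ℂ, ℂ) ω M]
    {M' : Type*} [TopologicalSpace M'] [T2Space M'] [SimplyConnectedSpace M']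
    [ChartedSpace ℂ M'] [IsManifold 𝓘(ℂ, ℂ) ω M']
    (π : M' → M) (hπ : IsCoveringMap π) (hπ_hol : IsLocalDiffeomorph 𝓘(ℂ, ℂ) 𝓘(ℂ, ℂ) ω π)
    (f N : M → ℍ[ℝ]) (hf : IsCMC f N)
    (s : ℝ) (α : M' → ℍ[ℝ])
    (hα : IsParallelN (N ∘ π) (Complex.exp (s * Complex.I)) α) (hα_ne : α ≠ 0)
    (fα : M' → ℍ[ℝ]) (hfα : IsAssociatedCMC (N ∘ π) s α fα) :
    (∃ c : ℝ, IsCMC (fun p => fα p - (c : ℍ[ℝ])) (gaugedNormal (N ∘ π) α)) ∧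
    (∃ S : M' → QMat, IsConformalGaussMap fα (gaugedNormal (N ∘ π) α) S) ∧
    ∀ S : M' → QMat, IsConformalGaussMap fα (gaugedNormal (N ∘ π) α) S →
      (∀ᶠ lam : Circle in 𝓝[≠] 1, ∃ Φ : M' → QGL,
        IsParallelFrame fα (gaugedNormal (N ∘ π) α) S (lam : ℂ) Φ) ∧
      ∀ Φ : Circle → M' → QGL,
        (∀ᶠ lam : Circle in 𝓝[≠] 1,
          IsParallelFrame fα (gaugedNormal (N ∘ π) α) S (lam : ℂ) (Φ lam)) →
        ∃ (m : Circle → QGL) (fΦ : Circle → M' → ℍ[ℝ]),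
          (∀ᶠ lam : Circle in 𝓝[≠] 1, ∀ p : M',
            moebius (m lam) (cwAssociated fα (Φ lam) p) = lineBundle (fΦ lam) p) ∧
          TendstoLocallyUniformly fΦ fα (𝓝[≠] 1) :=
  -- The CMC equations are local and π is holomorphic, so the lift of f is again CMC.
  associated_limit (hf.comp_localDiffeomorph hπ_hol) hα hα_ne hfα
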